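/- Let $n \ge 2$ and let $\pm[n]=\{\bar 1,\dots,\bar n,1,\dots,n\}$, where $\bar i=-i$. Let $B_n$ be the hyperoctahedral group, i.e. the group of permutations $w$ of $\pm[n]$ with $w(\bar x)=\overline{w(x)}$ for all $x$. Let $T$ be its set of reflections, i.e. the set of all conjugates in $B_n$ of the simple reflections $(1\ \bar 1)$ and $(i\ i{+}1)(\bar i\ \overline{i{+}1})$, $1\le i<n$. Write $\ell_T(w)$ for the least length of a word in $T$ with product $w$, and let $u\le_T v$ mean $\ell_T(v)=\ell_T(u)+\ell_T(u^{-1}v)$. Fix the Coxeter element $c=(\bar 1\ \bar 2\ \cdots\ \bar n\ 1\ 2\ \cdots\ n)$ and let $NC(B_n,c)=\{w\in B_n : e\le_T w\le_T c\}$, which is a lattice under $\le_T$. For $w\in B_n$ let $\pi_T(w)=\bigvee_{t\in T,\ t\le_T w} t$, the join being taken in $NC(B_n,c)$, let $\mathrm{Pop}_T(w)=w\cdot\pi_T(w)^{-1}$, and let $O_{\mathrm{Pop}_T}(w)=\{w,\mathrm{Pop}_T(w),\mathrm{Pop}_T^2(w),\dots\}$ be the forward orbit of $w$. Order $\pm[n]$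 by $\bar 1\prec\bar 2\prec\cdots\prec\bar n\prec 1\prec 2\prec\cdots\prec n$. An antiexceedance of $w\in B_n$ is an element $x\in\pm[n]$ with $x\prec w^{-1}(x)$. Call $w\in B_n$ *$B$-splittable* if $w$ has exactly $2n-2$ antiexceedances and $\pi_T(w)$, as a permutation of $\pm[n]$, has exactly one non-singleton cycle. Then an element $w\in B_n$ satisfies $|O_{\mathrm{Pop}_T}(w)|=2n-1$ if and only if $w$ is $B$-splittable. In particular, there are exactly $2^n-n-1$ elements $w\in B_n$ with $|O_{\mathrm{Pop}_T}(w)|=2n-1$. -/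

import Mathlib

section AbsoluteOrder

variable {G : Type*} [Group G]

/-- The `T`-word length `ℓ_T(w)`: the least length of a word in `T` with product `w`. -/
noncomputable def wordLength (T : Set G) (w : G) : ℕ :=
  sInf {k | ∃ l : List G, l.length = k ∧ (∀ t ∈ l, t ∈ T) ∧ l.prod = w}

/-- The absolute order `u ≤_T v`. -/
def AbsLE (T : Set G) (u v : G) : Prop :=
  wordLength T v = wordLength T u + wordLength T (u⁻¹ * v)

/-- The interval `[e, c]` of the absolute order. -/
def noncrossing (T : Set G) (c : G) : Set G :=
  {w | AbsLE T 1 w ∧ AbsLE T w c}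

/-- `v` is the join, taken in `[e, c]`, of all `t ∈ T` with `t ≤_T w`. -/
def IsNoncrossingJoin (T : Set G) (c w v : G) : Prop :=
  v ∈ noncrossing T c ∧ (∀ t ∈ T, AbsLE T t w → AbsLE T t v) ∧
    ∀ u ∈ noncrossing T c, (∀ t ∈ T, AbsLE T t w → AbsLE T t u) → AbsLE T v u

open Classical in
/-- The noncrossing projection `π_T(w, c)`, i.e. the join of `IsNoncrossingJoin`. The value `1` is
used only if there is no join, which does not occur for a finite Coxeter group with its set `T` of
reflections and a Coxeter element `c`, where `[e, c]` is a lattice. -/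
noncomputable def noncrossingProj (T : Set G) (c w : G) : G :=
  if h : ∃ v, IsNoncrossingJoin T c w v then h.choose else 1

/-- Coxeter pop-tsack torsing. -/
noncomputable def popT (T : Set G) (c w : G) : G :=
  w * (noncrossingProj T c w)⁻¹

end AbsoluteOrder

/-- The forward orbit `{x, f x, f (f x), …}`. -/
def forwardOrbit {X : Type*} (f : X → X) (x : X) : Set X :=
  Set.range fun k : ℕ => f^[k] x

/-- The set `±[n]` with the total order `1̄ ≺ ⋯ ≺ n̄ ≺ 1 ≺ ⋯ ≺ n`. The left summand is the barred
copy of `[n]`, the right summand the unbarred one; `i : Fin n` stands for the number `i + 1`. -/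
abbrev SignedPt (n : ℕ) : Type := Fin n ⊕ₗ Fin n

namespace SignedPt

variable {n : ℕ}

/-- The element `i + 1` of `±[n]`. -/
def pos (i : Fin n) : SignedPt n := toLex (Sum.inr i)

/-- The element `-(i + 1)` of `±[n]`. -/
def neg (i : Fin n) : SignedPt n := toLex (Sum.inl i)

/-- The negation `x ↦ x̄` on `±[n]`. -/
def bar (x : SignedPt n) : SignedPt n := toLex (Sum.swap (ofLex x))

/-- The elements of `±[n]`, listed as `1̄, …, n̄, 1, …, n`. -/
def points (n : ℕ) : List (SignedPt n) :=
  (List.finRange n).map neg ++ (List.finRange n).map pos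

end SignedPt

open SignedPt in
/-- The hyperoctahedral group `B_n`: the permutations `w` of `±[n]` with `w(x̄) = \overline{w(x)}`. -/
def hyperoctahedral (n : ℕ) : Subgroup (Equiv.Perm (SignedPt n)) where
  carrier := {w | ∀ x, w (bar x) = bar (w x)}
  one_mem' := fun _ => rfl
  mul_mem' := by
    intro a b ha hb x
    simp only [Equiv.Perm.mul_apply]
    rw [hb, ha]
  inv_mem' := by
    intro a ha x
    rw [Equiv.Perm.inv_eq_iff_eq, ha]
    simp

namespace Hyperoctahedral

open SignedPt

variable {n : ℕ}

/-- The simple reflections of `B_n`: `(1 1̄)` and `(i i+1)(ī \overline{i+1})` for `1 ≤ i < n`. -/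
def simpleReflections (n : ℕ) : Set (hyperoctahedral n) :=
  {s | (∃ i : Fin n, (i : ℕ) = 0 ∧
          (s : Equiv.Perm (SignedPt n)) = Equiv.swap (pos i) (neg i)) ∨
       (∃ i j : Fin n, (j : ℕ) = (i : ℕ) + 1 ∧
          (s : Equiv.Perm (SignedPt n)) =
            Equiv.swap (pos i) (pos j) * Equiv.swap (neg i) (neg j))}

/-- The set `T` of all reflections of `B_n`: the conjugates of the simple reflections. -/
def reflections (n : ℕ) : Set (hyperoctahedral n) :=
  Group.conjugatesOfSet (simpleReflections n)

theorem length_points (n : ℕ) : (points n).length = 2 * n := by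
  simp [points]; omega

theorem nodup_points (n : ℕ) : (points n).Nodup := by
  unfold points
  refine List.Nodup.append ?_ ?_ ?_
  · exact (List.nodup_finRange n).map (fun a b h => by simpa [neg] using h)
  · exact (List.nodup_finRange n).map (fun a b h => by simpa [pos] using h)
  · intro x hx hy
    simp only [List.mem_map] at hx hy
    obtain ⟨a, -, rfl⟩ := hx
    obtain ⟨b, -, h⟩ := hy
    simp [pos, neg] at h

theorem mem_points (x : SignedPt n) : x ∈ points n := by
  rcases x with i | i
  · exact List.mem_append_left _ (List.mem_map.2 ⟨i, List.mem_finRange i, rfl⟩)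
  · exact List.mem_append_right _ (List.mem_map.2 ⟨i, List.mem_finRange i, rfl⟩)

theorem bar_points (k : ℕ) (hk : k < (points n).length) :
    bar (points n)[k] = (points n)[(k + n) % (points n).length]'
      (Nat.mod_lt _ (by omega)) := by
  have hl := length_points n
  rcases lt_or_ge k n with h | h
  · have e : (k + n) % (points n).length = k + n := Nat.mod_eq_of_lt (by omega)
    simp only [e]
    simp [points, h, bar, pos, neg]
  · have e : (k + n) % (points n).length = k - n := by
      rw [hl, show k + n = (k - n) + 2 * n by omega, Nat.add_mod_right]
      exact Nat.mod_eq_of_lt (by omega)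
    simp only [e]
    have h1 : ¬ k < n := by omega
    have h2 : k - n < n := by omega
    simp [points, List.getElem_append, h1, h2, bar, pos, neg]

theorem formPerm_points_mem (n : ℕ) : (points n).formPerm ∈ hyperoctahedral n := by
  intro x
  obtain ⟨k, hk, rfl⟩ := List.getElem_of_mem (mem_points x)
  have hl := length_points n
  rw [List.formPerm_apply_getElem _ (nodup_points n), bar_points, bar_points,
    List.formPerm_apply_getElem _ (nodup_points n)]
  congr 1
  simp only [Nat.mod_add_mod]
  congr 1
  omega

/-- The Coxeter element `c = (1̄ 2̄ ⋯ n̄ 1 2 ⋯ n)` of `B_n`, as one cycle. -/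
def coxeterElement (n : ℕ) : hyperoctahedral n :=
  ⟨(points n).formPerm, formPerm_points_mem n⟩

/-- The noncrossing projection `π_T` on `B_n`. -/
noncomputable def piT (w : hyperoctahedral n) : hyperoctahedral n :=
  noncrossingProj (reflections n) (coxeterElement n) w

/-- The operator `Pop_T` on `B_n`. -/
noncomputable def pop (w : hyperoctahedral n) : hyperoctahedral n :=
  popT (reflections n) (coxeterElement n) w

/-- The number of antiexceedances of `w`, i.e. of `x ∈ ±[n]` with `x ≺ w⁻¹(x)`. -/
def aexc (w : hyperoctahedral n) : ℕ :=
  (Finset.univ.filter fun x : SignedPt n => x < (w : Equiv.Perm (SignedPt n))⁻¹ x).card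

/-- The number of non-singleton cycles of `w` as a permutation of `±[n]`. -/
def cyc (w : hyperoctahedral n) : ℕ :=
  (w : Equiv.Perm (SignedPt n)).cycleFactorsFinset.card

/-- `B`-splittable elements. The condition `aexc w = 2n - 2` is written without subtraction. -/
def IsSplittable (w : hyperoctahedral n) : Prop :=
  aexc w + 2 = 2 * n ∧ cyc (piT w) = 1

end Hyperoctahedral

/-! The proof turns the absolute order into noncrossing partitions, and `Pop_T` into an operation on
integer lifts that loses antiexceedances at a controlled rate.

Carter's argument on odd functions on ±[n] shows that reflection length is the codimension of the
fixed space (`wordLength_add_fixDim`). Multiplying by a reflection cuts blocks along a chord and its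
opposite (`rot_cut`). Hence the elements of `[e, c]` are exactly the rotations of bar-stable
noncrossing partitions, ordered by refinement, and `π_T(w)` rotates the blocks of the noncrossing
closure of the cycles of `w` (`rot_piT`).

Since `Pop_T(w)⁻¹ = π_T(w) w⁻¹`, one step moves each value of `w⁻¹` to the next point of its block.
An antiexceedance is lost exactly when the value is the maximum of a nontrivial block, so the loss
is the number of nontrivial cycles of `π_T(w)` (`aexc_eq_add_cyc`). Thus the orbit has at most `aexc
w + 1` elements, and it reaches this bound when every nonidentity term has a projection with a
single nontrivial cycle.

Lifting `w⁻¹` to `f : ℤ → ℤ` with `x < f x ≤ x + 2n` gives a juggling pattern with `2n - aexc w`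
balls (`IsLift.aexc_add_card_crossing`). One ball forces `w = c⁻¹`, with an orbit of size `2n`. Two
balls force the pattern determined by the `n`-periodic set `S` of points with `f x ≠ x + 1`
(`IsLift.isThrow_of_aexc`). If `S` is a single class modulo `n`, the closure has two nontrivial
blocks. Otherwise the inversions of `f` are so constrained by `S` that a single nontrivial block
persists along the whole orbit (`IsShuffle.rel`, `IsShuffle.pop`). So the splittable elements
correspond to the subsets of `[n]` with at least two elements. -/

namespace SignedPt

variable {n : ℕ}

/-! ### Signed points as integers modulo 2n -/

theorem bar_bar (x : SignedPt n) : bar (bar x) = x := by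
  rcases x with i | i <;> rfl

theorem bar_eq_iff (x y : SignedPt n) : bar x = y ↔ x = bar y :=
  ⟨fun h => by rw [← h, bar_bar], fun h => by rw [h, bar_bar]⟩

theorem bar_ne (x : SignedPt n) : bar x ≠ x := by
  rcases x with i | i
  · exact Sum.inr_ne_inl
  · exact Sum.inl_ne_inr

theorem pairwise_lt_points (n : ℕ) : (points n).Pairwise (· < ·) := by
  unfold points
  have h := List.pairwise_lt_finRange n
  refine List.pairwise_append.2 ⟨?_, ?_, ?_⟩
  · exact List.pairwise_map.2 (h.imp fun hab => Sum.Lex.inl_lt_inl_iff.2 hab)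
  · exact List.pairwise_map.2 (h.imp fun hab => Sum.Lex.inr_lt_inr_iff.2 hab)
  · intro a ha b hb
    obtain ⟨i, -, rfl⟩ := List.mem_map.1 ha
    obtain ⟨j, -, rfl⟩ := List.mem_map.1 hb
    exact Sum.Lex.inl_lt_inr _ _

variable [NeZero n]

theorem two_mul_pos (n : ℕ) [NeZero n] : (0 : ℤ) < 2 * n := by
  have := NeZero.pos n
  omega

theorem toNat_emod_lt (x : ℤ) : (x % (2 * n)).toNat < (points n).length := by
  have h := Int.emod_lt_of_pos x (two_mul_pos n)
  have h' := Int.emod_nonneg x (two_mul_pos n).ne'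
  rw [Hyperoctahedral.length_points]
  omega

/-- The `2n`-periodic enumeration `1̄, …, n̄, 1, …, n, 1̄, …` of `±[n]` by the integers. -/
def ofInt (x : ℤ) : SignedPt n := (points n)[(x % (2 * n)).toNat]'(toNat_emod_lt x)

theorem ofInt_eq_iff_emod {x y : ℤ} :
    (ofInt x : SignedPt n) = ofInt y ↔ x % (2 * n) = y % (2 * n) := by
  unfold ofInt
  rw [(Hyperoctahedral.nodup_points n).getElem_inj_iff]
  have h := Int.emod_nonneg x (two_mul_pos n).ne'
  have h' := Int.emod_nonneg y (two_mul_pos n).ne'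
  omega

theorem ofInt_eq_iff {x y : ℤ} :
    (ofInt x : SignedPt n) = ofInt y ↔ ∃ k : ℤ, y = x + 2 * n * k := by
  rw [ofInt_eq_iff_emod, ← Int.ModEq, Int.modEq_iff_dvd]
  exact ⟨fun ⟨k, hk⟩ => ⟨k, by linarith⟩, fun ⟨k, hk⟩ => ⟨k, by linarith⟩⟩

theorem ofInt_add_mul (x k : ℤ) : (ofInt (x + 2 * n * k) : SignedPt n) = ofInt x :=
  (ofInt_eq_iff.2 ⟨k, rfl⟩).symm

theorem ofInt_add_two_mul (x : ℤ) : (ofInt (x + 2 * n) : SignedPt n) = ofInt x := by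
  simpa using ofInt_add_mul (n := n) x 1

theorem eq_of_ofInt_eq {x y : ℤ} (h : (ofInt x : SignedPt n) = ofInt y)
    (h₁ : x < y + 2 * n) (h₂ : y < x + 2 * n) : x = y := by
  obtain ⟨k, rfl⟩ := ofInt_eq_iff.1 h
  have hn := two_mul_pos n
  have : k = 0 := by nlinarith
  simp [this]

theorem exists_ofInt_window (m : ℤ) (p : SignedPt n) :
    ∃ x, m ≤ x ∧ x < m + 2 * n ∧ ofInt x = p := by
  obtain ⟨k, hk, rfl⟩ := List.getElem_of_mem (Hyperoctahedral.mem_points p)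
  have hn := two_mul_pos n
  refine ⟨m + ((k : ℤ) - m) % (2 * n), ?_, ?_, ?_⟩
  · have := Int.emod_nonneg ((k : ℤ) - m) hn.ne'
    omega
  · have := Int.emod_lt_of_pos ((k : ℤ) - m) hn
    omega
  · rw [Hyperoctahedral.length_points] at hk
    have : (m + ((k : ℤ) - m) % (2 * n)) % (2 * n) = k := by
      rw [Int.add_emod_emod, add_sub_cancel]
      exact Int.emod_eq_of_lt (by omega) (by omega)
    simp only [ofInt, this, Int.toNat_natCast]

theorem ofInt_surjective : Function.Surjective (ofInt : ℤ → SignedPt n) := fun p => by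
  obtain ⟨x, -, -, h⟩ := exists_ofInt_window 0 p
  exact ⟨x, h⟩

theorem ofInt_add_self (x : ℤ) : (ofInt (x + n) : SignedPt n) = bar (ofInt x) := by
  unfold ofInt
  rw [Hyperoctahedral.bar_points]
  congr 1
  have h := Int.emod_nonneg x (two_mul_pos n).ne'
  have h' := Int.emod_nonneg (x + n) (two_mul_pos n).ne'
  rw [Hyperoctahedral.length_points]
  zify
  rw [Int.toNat_of_nonneg h, Int.toNat_of_nonneg h', Int.emod_add_emod]

theorem ofInt_lt_iff {x y : ℤ} (hx : 0 ≤ x) (hx' : x < 2 * n) (hy : 0 ≤ y) (hy' : y < 2 * n) :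
    (ofInt x : SignedPt n) < ofInt y ↔ x < y := by
  have key : ∀ a b : ℤ, 0 ≤ a → a < 2 * n → 0 ≤ b → b < 2 * n → a < b →
      (ofInt a : SignedPt n) < ofInt b := by
    intro a b ha ha' hb hb' hab
    unfold ofInt
    refine List.pairwise_iff_getElem.1 (pairwise_lt_points n) _ _ _ _ ?_
    rw [Int.emod_eq_of_lt ha ha', Int.emod_eq_of_lt hb hb']
    omega
  refine ⟨fun h => ?_, key x y hx hx' hy hy'⟩
  rcases lt_trichotomy x y with h' | h' | h'
  · exact h'
  · rw [h'] at h
    exact absurd h (lt_irrefl _)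
  · exact absurd (key y x hy hy' hx hx' h') (lt_asymm h)

theorem coxeterElement_ofInt (x : ℤ) :
    (Hyperoctahedral.coxeterElement n : Equiv.Perm (SignedPt n)) (ofInt x) = ofInt (x + 1) := by
  unfold ofInt
  change (points n).formPerm _ = _
  rw [List.formPerm_apply_getElem _ (Hyperoctahedral.nodup_points n)]
  congr 1
  have h := Int.emod_nonneg x (two_mul_pos n).ne'
  have h' := Int.emod_nonneg (x + 1) (two_mul_pos n).ne'
  rw [Hyperoctahedral.length_points]
  zify
  rw [Int.toNat_of_nonneg h, Int.toNat_of_nonneg h', Int.emod_add_emod]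

end SignedPt

/-! ### Elements of B_n from lifts to the integers -/

namespace Hyperoctahedral

open SignedPt

variable {n : ℕ}

theorem apply_bar (w : hyperoctahedral n) (x : SignedPt n) : w.1 (bar x) = bar (w.1 x) := w.2 x

variable [NeZero n]

/-- A function on `ℤ` that commutes with the shift by `n` and is injective modulo `2n` induces an
element of `B_n`. -/
theorem exists_of_lift (f : ℤ → ℤ) (hf : ∀ x, f (x + n) = f x + n)
    (hinj : ∀ x y, (ofInt (f x) : SignedPt n) = ofInt (f y) → (ofInt x : SignedPt n) = ofInt y) :
    ∃ w : hyperoctahedral n, ∀ x, (w : Equiv.Perm (SignedPt n)) (ofInt x) = ofInt (f x) := by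
  have hf2 : ∀ x, f (x + 2 * n) = f x + 2 * n := fun x => by
    rw [two_mul, ← add_assoc, hf, hf, add_assoc]
  have hfk : ∀ x k, (ofInt (f (x + 2 * n * k)) : SignedPt n) = ofInt (f x) := by
    intro x k
    induction k using Int.induction_on with
    | zero => simp
    | succ k ih =>
      rw [mul_add, mul_one, ← add_assoc, hf2, ofInt_add_two_mul, ih]
    | pred k ih =>
      rw [← ih, ← ofInt_add_two_mul, ← hf2]
      congr 2
      ring
  obtain ⟨g, hg⟩ := (ofInt_surjective (n := n)).hasRightInverse
  have key : ∀ x, (ofInt (f (g (ofInt x))) : SignedPt n) = ofInt (f x) := fun x => by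
    obtain ⟨k, hk⟩ := ofInt_eq_iff.1 (hg (ofInt x))
    conv_rhs => rw [hk, hfk]
  let F : SignedPt n → SignedPt n := fun p => ofInt (f (g p))
  have hF : Function.Bijective F := Finite.injective_iff_bijective.1 fun p q h => by
    rw [← hg p, ← hg q]
    exact hinj _ _ h
  refine ⟨⟨Equiv.ofBijective F hF, fun p => ?_⟩, fun x => key x⟩
  obtain ⟨x, rfl⟩ := ofInt_surjective p
  change F (bar (ofInt x)) = bar (F (ofInt x))
  simp only [F]
  rw [← ofInt_add_self, key, key, hf, ofInt_add_self]

theorem ext_ofInt {u v : hyperoctahedral n}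
    (h : ∀ x, (u : Equiv.Perm (SignedPt n)) (ofInt x) = (v : Equiv.Perm (SignedPt n)) (ofInt x)) :
    u = v := by
  apply Subtype.ext
  ext p : 1
  obtain ⟨x, rfl⟩ := ofInt_surjective p
  exact h x

end Hyperoctahedral

/-! ### Reflections as signed exchanges of two points -/

namespace Hyperoctahedral

open SignedPt

variable {n : ℕ}

/-- The map underlying the reflection that exchanges `x` with `y` and `x̄` with `ȳ`. -/
def reflFun (x y z : SignedPt n) : SignedPt n :=
  if z = x then y else if z = y then x else if z = bar x then bar y else
    if z = bar y then bar x else z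

theorem reflFun_involutive (x y : SignedPt n) : Function.Involutive (reflFun x y) := by
  intro z
  have h₁ := bar_bar x
  have h₂ := bar_bar y
  have h₃ := bar_bar z
  have h₄ := bar_ne x
  have h₅ := bar_ne y
  have h₆ := bar_ne z
  grind [reflFun]

theorem reflFun_bar (x y z : SignedPt n) : reflFun x y (bar z) = bar (reflFun x y z) := by
  have h₁ := bar_bar x
  have h₂ := bar_bar y
  have h₃ := bar_bar z
  have h₄ := bar_ne x
  have h₅ := bar_ne y
  have h₆ := bar_ne z
  grind [reflFun]

/-- The element of `B_n` that exchanges `x` with `y` and `x̄` with `ȳ`. -/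
def refl (x y : SignedPt n) : hyperoctahedral n :=
  ⟨(reflFun_involutive x y).toPerm, reflFun_bar x y⟩

theorem refl_apply (x y z : SignedPt n) : (refl x y).1 z =
    if z = x then y else if z = y then x else if z = bar x then bar y else
    if z = bar y then bar x else z := rfl

theorem refl_left (x y : SignedPt n) : (refl x y).1 x = y := by simp [refl_apply]

theorem refl_right (x y : SignedPt n) : (refl x y).1 y = x := by
  have h := reflFun_involutive x y x
  rwa [show reflFun x y x = y from refl_left x y] at h

theorem refl_of_ne {x y z : SignedPt n} (h₁ : z ≠ x) (h₂ : z ≠ y) (h₃ : z ≠ bar x)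
    (h₄ : z ≠ bar y) : (refl x y).1 z = z := by simp [refl_apply, *]

theorem refl_refl (x y z : SignedPt n) : (refl x y).1 ((refl x y).1 z) = z :=
  reflFun_involutive x y z

theorem refl_mul_self (x y : SignedPt n) : refl x y * refl x y = 1 := by
  apply Subtype.ext
  ext z : 1
  exact refl_refl x y z

theorem refl_inv (x y : SignedPt n) : (refl x y)⁻¹ = refl x y :=
  inv_eq_of_mul_eq_one_left (refl_mul_self x y)

theorem refl_comm (x y : SignedPt n) : refl x y = refl y x := by
  apply Subtype.ext
  ext z : 1
  rw [refl_apply, refl_apply]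
  split_ifs <;> simp_all

theorem conj_refl (w : hyperoctahedral n) (x y : SignedPt n) :
    w * refl x y * w⁻¹ = refl (w.1 x) (w.1 y) := by
  rw [mul_inv_eq_iff_eq_mul]
  apply Subtype.ext
  ext z : 1
  change w.1 ((refl x y).1 z) = (refl (w.1 x) (w.1 y)).1 (w.1 z)
  simp only [refl_apply, ← apply_bar, EmbeddingLike.apply_eq_iff_eq]
  split_ifs <;> rfl

theorem refl_pos_neg (i : Fin n) :
    (refl (pos i) (neg i)).1 = Equiv.swap (pos i) (neg i) := by
  ext z : 1
  have h₁ : bar (pos i) = neg i := rfl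
  have h₂ : bar (neg i) = pos i := rfl
  rw [refl_apply, Equiv.swap_apply_def, h₁, h₂]
  split_ifs <;> simp_all

theorem refl_pos_pos {i j : Fin n} (hij : i ≠ j) : (refl (pos i) (pos j)).1 =
    Equiv.swap (pos i) (pos j) * Equiv.swap (neg i) (neg j) := by
  ext z : 1
  have h₁ : bar (pos i) = neg i := rfl
  have h₂ : bar (pos j) = neg j := rfl
  have h₃ : ∀ k l : Fin n, pos k ≠ neg l := fun k l => Sum.inr_ne_inl
  have h₄ : ∀ k l : Fin n, neg k ≠ pos l := fun k l => Sum.inl_ne_inr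
  have h₅ : neg i ≠ neg j := fun h => hij (Sum.inl_injective h)
  have h₆ : pos i ≠ pos j := fun h => hij (Sum.inr_injective h)
  rw [refl_apply, Equiv.Perm.mul_apply, Equiv.swap_apply_def, Equiv.swap_apply_def, h₁, h₂]
  split_ifs <;> simp_all

theorem conj_mem_reflections {t : hyperoctahedral n} (ht : t ∈ reflections n)
    (w : hyperoctahedral n) : w * t * w⁻¹ ∈ reflections n :=
  Group.conj_mem_conjugatesOfSet ht

theorem exists_refl_of_mem {t : hyperoctahedral n} (ht : t ∈ reflections n) :
    ∃ x y, x ≠ y ∧ t = refl x y := by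
  obtain ⟨s, hs, hst⟩ := Group.mem_conjugatesOfSet_iff.1 ht
  obtain ⟨w, rfl⟩ := isConj_iff.1 hst
  rcases hs with ⟨i, -, hi⟩ | ⟨i, j, hij, h⟩
  · rw [show s = _ from Subtype.ext (hi.trans (refl_pos_neg i).symm), conj_refl]
    exact ⟨_, _, fun h => Sum.inr_ne_inl (w.1.injective h), rfl⟩
  · have hne : i ≠ j := fun h => by rw [h] at hij; omega
    rw [show s = _ from Subtype.ext (h.trans (refl_pos_pos hne).symm), conj_refl]
    exact ⟨_, _, fun h => hne (Sum.inr_injective (w.1.injective h)), rfl⟩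

theorem simple_mem_reflections {s : hyperoctahedral n} (hs : s ∈ simpleReflections n) :
    s ∈ reflections n :=
  Group.mem_conjugatesOfSet_iff.2 ⟨s, hs, IsConj.refl s⟩

theorem coxeterElement_zpow_ofInt [NeZero n] (k x : ℤ) :
    ((coxeterElement n) ^ k).1 (ofInt x) = ofInt (x + k) := by
  have hnat : ∀ (m : ℕ) (y : ℤ), ((coxeterElement n) ^ m).1 (ofInt y) = ofInt (y + m) := by
    intro m
    induction m with
    | zero => intro y; simp
    | succ m ih =>
      intro y
      rw [pow_succ]
      change ((coxeterElement n) ^ m).1 ((coxeterElement n).1 (ofInt y)) = _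
      rw [coxeterElement_ofInt, ih]
      push_cast
      congr 1
      ring
  obtain ⟨m, rfl | rfl⟩ := k.eq_nat_or_neg
  · rw [zpow_natCast, hnat]
  · rw [zpow_neg, zpow_natCast]
    change ((coxeterElement n) ^ m).1.symm (ofInt x) = _
    rw [Equiv.symm_apply_eq, hnat]
    congr 1
    ring

theorem exists_apply_eq [NeZero n] (x y : SignedPt n) : ∃ w : hyperoctahedral n, w.1 x = y := by
  obtain ⟨a, rfl⟩ := ofInt_surjective x
  obtain ⟨b, rfl⟩ := ofInt_surjective y
  exact ⟨(coxeterElement n) ^ (b - a), by rw [coxeterElement_zpow_ofInt]; congr 1; ring⟩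

theorem refl_mem_reflections (hn : 2 ≤ n) {x y : SignedPt n} (hxy : x ≠ y) :
    refl x y ∈ reflections n := by
  have : NeZero n := ⟨by omega⟩
  by_cases hy : y = bar x
  · obtain ⟨w, hw⟩ := exists_apply_eq (pos ⟨0, by omega⟩) x
    have h : refl (pos ⟨0, by omega⟩) (neg ⟨0, by omega⟩) ∈ reflections n :=
      simple_mem_reflections (Or.inl ⟨⟨0, by omega⟩, rfl, refl_pos_neg _⟩)
    have := conj_mem_reflections h w
    rw [conj_refl, hw] at this
    rw [hy]
    convert this
    rw [← hw, ← apply_bar]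
    rfl
  · obtain ⟨w, hw⟩ := exists_apply_eq (pos ⟨0, by omega⟩) x
    have h : refl (pos ⟨0, by omega⟩) (pos ⟨1, by omega⟩) ∈ reflections n :=
      simple_mem_reflections
        (Or.inr ⟨⟨0, by omega⟩, ⟨1, by omega⟩, rfl, refl_pos_pos (by simp)⟩)
    -- The first conjugation brings one endpoint to `x`. The second, by a reflection that fixes `x`,
    -- carries the other endpoint to `y`.
    have h2 := conj_mem_reflections (conj_mem_reflections h w)
      (refl (w.1 (pos ⟨1, by omega⟩)) y)
    rw [conj_refl, conj_refl, hw, refl_left] at h2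
    have h01 : (pos ⟨0, by omega⟩ : SignedPt n) ≠ pos ⟨1, by omega⟩ := by
      intro h; simpa using Sum.inr_injective h
    rwa [refl_of_ne] at h2
    · rw [← hw]; exact fun h => h01 (w.1.injective h)
    · exact hxy
    · rw [← hw, ← apply_bar]
      exact fun h => Sum.inr_ne_inl (w.1.injective h)
    · rw [Ne, eq_comm, bar_eq_iff]; exact hy

end Hyperoctahedral

/-! ### The fixed space in the reflection representation -/

namespace Hyperoctahedral

open SignedPt

variable {n : ℕ}

/-- The odd functions on `±[n]` that are invariant under `w`. -/
def fixOdd (w : hyperoctahedral n) : Submodule ℚ (SignedPt n → ℚ) where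
  carrier := {g | (∀ x, g (bar x) = -g x) ∧ ∀ x, g (w.1 x) = g x}
  add_mem' := by
    rintro g h ⟨hg, hg'⟩ ⟨hh, hh'⟩
    exact ⟨fun x => by simp only [Pi.add_apply, hg, hh]; ring,
      fun x => by simp only [Pi.add_apply, hg', hh']⟩
  zero_mem' := ⟨fun x => by simp, fun x => rfl⟩
  smul_mem' := by
    rintro a g ⟨hg, hg'⟩
    exact ⟨fun x => by simp only [Pi.smul_apply, hg, smul_eq_mul]; ring,
      fun x => by simp only [Pi.smul_apply, hg']⟩

/-- The dimension of the space of odd `w`-invariant functions. -/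
noncomputable def fixDim (w : hyperoctahedral n) : ℕ := Module.finrank ℚ (fixOdd w)

theorem fixOdd_le_one (w : hyperoctahedral n) : fixOdd w ≤ fixOdd 1 :=
  fun _ hg => ⟨hg.1, fun _ => rfl⟩

/-- Odd functions are determined by their values on the unbarred points. -/
def oddEquiv (n : ℕ) : fixOdd (1 : hyperoctahedral n) ≃ₗ[ℚ] (Fin n → ℚ) where
  toFun g i := g.1 (pos i)
  map_add' _ _ := rfl
  map_smul' _ _ := rfl
  invFun h := ⟨fun x => Sum.elim (fun i => -h i) h (ofLex x), by
    refine ⟨fun x => ?_, fun x => rfl⟩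
    rcases x with i | i
    · exact (neg_neg _).symm
    · rfl⟩
  left_inv g := by
    apply Subtype.ext
    funext x
    rcases x with i | i
    · exact (g.2.1 (pos i)).symm
    · rfl
  right_inv h := rfl

theorem fixDim_one : fixDim (1 : hyperoctahedral n) = n := by
  rw [fixDim, (oddEquiv n).finrank_eq, Module.finrank_fin_fun]

theorem fixDim_le (w : hyperoctahedral n) : fixDim w ≤ n := by
  exact (Submodule.finrank_mono (fixOdd_le_one w)).trans_eq fixDim_one

/-- The representation is faithful: the odd function `δ_x - δ_x̄` is not invariant under an element
that moves `x`. -/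
theorem eq_one_of_fixDim {w : hyperoctahedral n} (h : fixDim w = n) : w = 1 := by
  have he : fixOdd w = fixOdd 1 :=
    Submodule.eq_of_le_of_finrank_eq (fixOdd_le_one w) (h.trans fixDim_one.symm)
  apply Subtype.ext
  ext x : 1
  by_contra hx
  classical
  let g : SignedPt n → ℚ := fun z => (if z = x then 1 else 0) - if z = bar x then 1 else 0
  have hg : g ∈ fixOdd w := by
    rw [he]
    refine ⟨fun z => ?_, fun z => rfl⟩
    simp only [g, bar_eq_iff, bar_bar]
    ring
  have := hg.2 x
  have hb := (bar_ne x).symm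
  have hwx : w.1 x ≠ x := hx
  simp only [g, hwx, if_true, if_false, hb] at this
  split_ifs at this <;> norm_num at this

theorem inf_fixOdd_le (u v : hyperoctahedral n) : fixOdd u ⊓ fixOdd v ≤ fixOdd (u * v) :=
  fun _ hg => ⟨hg.1.1, fun x => (hg.1.2 (v.1 x)).trans (hg.2.2 x)⟩

/-- This is the dimension formula for a sum and an intersection inside the `n`-dimensional space of
all odd functions. -/
theorem fixDim_add_le_inf (u v : hyperoctahedral n) :
    fixDim u + fixDim v ≤ Module.finrank ℚ ↑(fixOdd u ⊓ fixOdd v) + n := by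
  have h := Submodule.finrank_sup_add_finrank_inf_eq (fixOdd u) (fixOdd v)
  have h' : Module.finrank ℚ ↑(fixOdd u ⊔ fixOdd v) ≤ n :=
    (Submodule.finrank_mono (sup_le (fixOdd_le_one u) (fixOdd_le_one v))).trans_eq fixDim_one
  unfold fixDim
  omega

theorem fixDim_add_le_mul (u v : hyperoctahedral n) :
    fixDim u + fixDim v ≤ fixDim (u * v) + n :=
  (fixDim_add_le_inf u v).trans
    (Nat.add_le_add_right (Submodule.finrank_mono (inf_fixOdd_le u v)) n)

/-- If the codimensions of the fixed spaces add up, then the fixed space of a product is the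
intersection of those of the factors. -/
theorem fixOdd_mul_eq_inf {u v : hyperoctahedral n}
    (h : fixDim u + fixDim v = fixDim (u * v) + n) : fixOdd (u * v) = fixOdd u ⊓ fixOdd v := by
  refine (Submodule.eq_of_le_of_finrank_le (inf_fixOdd_le u v) ?_).symm
  have := fixDim_add_le_inf u v
  unfold fixDim at *
  omega

theorem mem_fixOdd_refl {x y : SignedPt n} {g : SignedPt n → ℚ} :
    g ∈ fixOdd (refl x y) ↔ g ∈ fixOdd (1 : hyperoctahedral n) ∧ g x = g y := by
  constructor
  · intro hg
    exact ⟨fixOdd_le_one _ hg, by rw [← hg.2 x, refl_left]⟩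
  · rintro ⟨hg, hxy⟩
    refine ⟨hg.1, fun z => ?_⟩
    rw [refl_apply]
    have h₁ := hg.1 x
    have h₂ := hg.1 y
    split_ifs <;> simp_all

theorem fixDim_refl_ge (x y : SignedPt n) : n ≤ fixDim (refl x y) + 1 := by
  let φ : (SignedPt n → ℚ) →ₗ[ℚ] ℚ :=
    (LinearMap.proj x : (SignedPt n → ℚ) →ₗ[ℚ] ℚ) - LinearMap.proj y
  have he : fixOdd (refl x y) = fixOdd 1 ⊓ LinearMap.ker φ := by
    ext g
    rw [mem_fixOdd_refl, Submodule.mem_inf, LinearMap.mem_ker]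
    simp [φ, sub_eq_zero]
  have h := Submodule.finrank_sup_add_finrank_inf_eq (fixOdd (1 : hyperoctahedral n))
    (LinearMap.ker φ)
  have h₁ := LinearMap.finrank_range_add_finrank_ker φ
  have h₂ : Module.finrank ℚ (LinearMap.range φ) ≤ 1 := by
    simpa using Submodule.finrank_le (LinearMap.range φ)
  have h₃ := Submodule.finrank_le (fixOdd (1 : hyperoctahedral n) ⊔ LinearMap.ker φ)
  have h₄ := fixDim_one (n := n)
  unfold fixDim at *
  rw [he]
  omega

open Classical in
/-- The odd function `δ_x - δ_x̄`. -/
noncomputable def oddDelta (x z : SignedPt n) : ℚ :=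
  (if z = x then 1 else 0) - if z = bar x then 1 else 0

theorem oddDelta_bar_right (x z : SignedPt n) : oddDelta x (bar z) = -oddDelta x z := by
  simp only [oddDelta, bar_eq_iff, bar_bar]
  ring

theorem oddDelta_bar_left (x z : SignedPt n) : oddDelta (bar x) z = -oddDelta x z := by
  simp only [oddDelta, bar_bar]
  ring

theorem oddDelta_self (x : SignedPt n) : oddDelta x x = 1 := by
  simp [oddDelta, (bar_ne x).symm]

theorem oddDelta_of_ne {x z : SignedPt n} (h : z ≠ x) (h' : z ≠ bar x) : oddDelta x z = 0 := by
  simp [oddDelta, h, h']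

theorem oddDelta_apply (w : hyperoctahedral n) (x z : SignedPt n) :
    oddDelta (w.1 x) (w.1 z) = oddDelta x z := by
  simp only [oddDelta, ← apply_bar, EmbeddingLike.apply_eq_iff_eq]

theorem sum_mul_oddDelta {g : SignedPt n → ℚ} (hg : ∀ z, g (bar z) = -g z) (x : SignedPt n) :
    ∑ z, g z * oddDelta x z = 2 * g x := by
  simp only [oddDelta, mul_sub, mul_ite, mul_one, mul_zero, Finset.sum_sub_distrib,
    Finset.sum_ite_eq', Finset.mem_univ, if_true, hg]
  ring

/-- `δ_y - δ_x` (made odd) lies in the image of `w - 1` on the odd functions. -/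
def MovRel (w : hyperoctahedral n) (x y : SignedPt n) : Prop :=
  ∃ β : SignedPt n → ℚ, (∀ z, β (bar z) = -β z) ∧
    ∀ z, β z - β (w.1 z) = oddDelta y (w.1 z) - oddDelta x (w.1 z)

theorem MovRel.rfl {w : hyperoctahedral n} {x : SignedPt n} : MovRel w x x :=
  ⟨0, by simp, by simp⟩

theorem MovRel.trans {w : hyperoctahedral n} {x y z : SignedPt n} (h : MovRel w x y)
    (h' : MovRel w y z) : MovRel w x z := by
  obtain ⟨β, hβ, h⟩ := h
  obtain ⟨γ, hγ, h'⟩ := h'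
  refine ⟨β + γ, fun z => by simp only [Pi.add_apply, hβ, hγ]; ring, fun z => ?_⟩
  simp only [Pi.add_apply]
  linarith [h z, h' z]

theorem movRel_apply (w : hyperoctahedral n) (x : SignedPt n) : MovRel w x (w.1 x) :=
  ⟨oddDelta x, oddDelta_bar_right x, fun z => by rw [oddDelta_apply]⟩

theorem movRel_of_sameCycle {w : hyperoctahedral n} {x y : SignedPt n}
    (h : w.1.SameCycle x y) : MovRel w x y := by
  obtain ⟨k, rfl⟩ := h.exists_nat_pow_eq
  induction k with
  | zero => exact MovRel.rfl
  | succ k ih =>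
    rw [pow_succ', Equiv.Perm.mul_apply]
    exact (ih ⟨k, by simp⟩).trans (movRel_apply w _)

/-- Multiplication by a reflection whose root is moved by `w` enlarges the fixed space. -/
theorem fixDim_lt_of_movRel {w : hyperoctahedral n} {x y : SignedPt n} (hxy : x ≠ y)
    (h : MovRel w x y) : fixDim w < fixDim (refl x y * w) := by
  obtain ⟨β, hβ, h⟩ := h
  -- The root `δ_y - δ_x` lies in the image of `w - 1`, so it is orthogonal to every `w`-invariant
  -- function.
  have hle : fixOdd w ≤ fixOdd (refl x y) := by
    intro g hg
    refine mem_fixOdd_refl.2 ⟨fixOdd_le_one _ hg, ?_⟩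
    have h₁ : ∑ z, g (w.1 z) * (β z - β (w.1 z)) =
        ∑ z, g (w.1 z) * (oddDelta y (w.1 z) - oddDelta x (w.1 z)) :=
      Finset.sum_congr rfl fun z _ => by rw [h]
    rw [Equiv.sum_comp w.1 fun z => g z * (oddDelta y z - oddDelta x z)] at h₁
    simp only [mul_sub, Finset.sum_sub_distrib, sum_mul_oddDelta hg.1] at h₁
    rw [Equiv.sum_comp w.1 fun z => g z * β z] at h₁
    simp only [hg.2] at h₁
    linarith
  have hα : ∑ z, (oddDelta y z - oddDelta x z) * (oddDelta y z - oddDelta x z) =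
      2 * ((oddDelta y y - oddDelta x y) - (oddDelta y x - oddDelta x x)) := by
    have ho : ∀ z, oddDelta y (bar z) - oddDelta x (bar z) =
        -(oddDelta y z - oddDelta x z) := fun z => by
      rw [oddDelta_bar_right, oddDelta_bar_right]; ring
    simp only [mul_sub (oddDelta y _ - oddDelta x _) (oddDelta y _), Finset.sum_sub_distrib]
    rw [sum_mul_oddDelta ho, sum_mul_oddDelta ho]
    ring
  -- Let `α` be the root. Since `β = (β + α) ∘ w`, the functions `β` and `β + α` have the same norm,
  -- so the reflection in `α` exchanges them. This makes `β` a new invariant of the product.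
  have hnorm : 2 * (2 * (β y - β x)) +
      2 * ((oddDelta y y - oddDelta x y) - (oddDelta y x - oddDelta x x)) = 0 := by
    rw [← hα]
    have h₁ : ∑ z, β z * β z = ∑ z, (β (w.1 z) + (oddDelta y (w.1 z) - oddDelta x (w.1 z))) *
        (β (w.1 z) + (oddDelta y (w.1 z) - oddDelta x (w.1 z))) :=
      Finset.sum_congr rfl fun z _ => by rw [← h]; ring
    rw [Equiv.sum_comp w.1 fun z => (β z + (oddDelta y z - oddDelta x z)) *
        (β z + (oddDelta y z - oddDelta x z))] at h₁
    have h₂ : ∀ z, (β z + (oddDelta y z - oddDelta x z)) *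
        (β z + (oddDelta y z - oddDelta x z)) = β z * β z +
        2 * (β z * oddDelta y z - β z * oddDelta x z) +
        (oddDelta y z - oddDelta x z) * (oddDelta y z - oddDelta x z) := fun z => by ring
    simp only [h₂, Finset.sum_add_distrib, ← Finset.mul_sum, Finset.sum_sub_distrib,
      sum_mul_oddDelta hβ] at h₁
    linarith
  rw [oddDelta_self, oddDelta_self] at hnorm
  have hα' : oddDelta y x = oddDelta x y := by
    simp only [oddDelta]
    congr 2
    · exact propext eq_comm
    · exact propext ⟨fun h => by rw [h, bar_bar], fun h => by rw [h, bar_bar]⟩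
  refine Submodule.finrank_lt_finrank_of_lt (lt_of_le_of_ne (fun g hg => ?_) fun he => ?_)
  · exact inf_fixOdd_le _ _ ⟨hle hg, hg⟩
  · have hmem : β ∈ fixOdd (refl x y * w) := by
      refine ⟨hβ, fun z => ?_⟩
      change β ((refl x y).1 (w.1 z)) = β z
      rw [show β z = β (w.1 z) + (oddDelta y (w.1 z) - oddDelta x (w.1 z)) by linarith [h z]]
      generalize w.1 z = p
      by_cases hy : y = bar x
      · subst hy
        rw [hβ, oddDelta_bar_right, oddDelta_self, oddDelta_bar_left, oddDelta_self] at hnorm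
        rw [oddDelta_bar_left, refl_apply, bar_bar]
        have hb := bar_ne x
        by_cases h₁ : p = x
        · subst h₁; simp only [if_true, hβ, oddDelta_self]; linarith
        by_cases h₂ : p = bar x
        · subst h₂; simp only [hb, if_true, if_false, hβ, oddDelta_self, oddDelta_bar_right]
          linarith
        simp [h₁, h₂, oddDelta_of_ne h₁ h₂]
      · have hx : x ≠ bar y := fun hx => hy (by rw [hx, bar_bar])
        rw [hα', oddDelta_of_ne (Ne.symm hxy) hy] at hnorm
        have e₁ : oddDelta y x = 0 := oddDelta_of_ne hxy hx
        have e₂ : oddDelta x y = 0 := oddDelta_of_ne hxy.symm hy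
        by_cases h₁ : p = x
        · subst h₁; rw [refl_left, oddDelta_self, e₁]; linarith
        by_cases h₂ : p = y
        · subst h₂; rw [refl_right, oddDelta_self, e₂]; linarith
        by_cases h₃ : p = bar x
        · subst h₃
          rw [apply_bar, refl_left, oddDelta_bar_right, oddDelta_bar_right, hβ, hβ, e₁,
            oddDelta_self]
          linarith
        by_cases h₄ : p = bar y
        · subst h₄
          rw [apply_bar, refl_right, oddDelta_bar_right, oddDelta_bar_right, hβ, hβ, e₂,
            oddDelta_self]
          linarith
        rw [refl_of_ne h₁ h₂ h₃ h₄, oddDelta_of_ne h₁ h₃, oddDelta_of_ne h₂ h₄]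
        ring
    -- If `β` were already `w`-invariant, the root would vanish at `y`.
    rw [← he] at hmem
    have h₁ := h (w.1⁻¹ y)
    rw [hmem.2, sub_self, show w.1 (w.1⁻¹ y) = y from w.1.apply_symm_apply y, oddDelta_self] at h₁
    have h₂ : oddDelta x y = 1 := by linarith
    simp only [oddDelta, hxy.symm, if_false] at h₂
    split_ifs at h₂ <;> norm_num at h₂

/-- The relation of lying on one cycle, or on two cycles stable under the bar. -/
theorem sameCycle_or_balanced_of_fixOdd_le {w : hyperoctahedral n} {x y : SignedPt n}
    (h : fixOdd w ≤ fixOdd (refl x y)) : w.1.SameCycle x y ∨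
      (w.1.SameCycle x (bar x) ∧ w.1.SameCycle y (bar y)) := by
  classical
  -- The witness is the indicator of the cycle of `a` minus that of the opposite cycle; the two are
  -- disjoint by assumption.
  have key : ∀ a, ¬ w.1.SameCycle a (bar a) → ∃ g ∈ fixOdd w, g a = 1 ∧
      ∀ z, g z ≠ 0 → w.1.SameCycle a z ∨ w.1.SameCycle a (bar z) := by
    intro a ha
    refine ⟨fun z => (if w.1.SameCycle a z then 1 else 0) -
      if w.1.SameCycle a (bar z) then 1 else 0, ⟨fun z => ?_, fun z => ?_⟩, ?_, ?_⟩
    · simp only [bar_bar]; ring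
    · simp only [← apply_bar, Equiv.Perm.sameCycle_apply_right]
    · simp [ha, Equiv.Perm.SameCycle.refl]
    · intro z hz
      by_contra! hc
      simp [hc.1, hc.2] at hz
  have hbar : ∀ a b, w.1.SameCycle a b → w.1.SameCycle (bar a) (bar b) := by
    rintro a b ⟨k, rfl⟩
    refine ⟨k, ?_⟩
    exact (w ^ k).2 a
  by_contra! hc
  by_cases hx : w.1.SameCycle x (bar x)
  · have hy := hc.2 hx
    obtain ⟨g, hg, h₁, h₂⟩ := key y hy
    have h₃ := (mem_fixOdd_refl.1 (h hg)).2
    rcases h₂ x (by rw [h₃, h₁]; norm_num) with h₄ | h₄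
    · exact hc.1 h₄.symm
    · exact hc.1 (hx.trans h₄.symm)
  · obtain ⟨g, hg, h₁, h₂⟩ := key x hx
    have h₃ := (mem_fixOdd_refl.1 (h hg)).2
    rcases h₂ y (by rw [← h₃, h₁]; norm_num) with h₄ | h₄
    · exact hc.1 h₄
    -- Here `y` is on the cycle opposite to that of `x`, where `g` is `-1`, against `g y = g x = 1`.
    · have h₆ : g y = -g (bar y) := by rw [hg.1, neg_neg]
      obtain ⟨k, hk⟩ := h₄
      have h₇ : g (bar y) = g x := by
        rw [← hk]
        have hinv : ∀ k : ℤ, g ((w.1 ^ k) x) = g x := by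
          intro k
          induction k using Int.induction_on with
          | zero => simp
          | succ k ih => rw [add_comm, zpow_add, zpow_one, Equiv.Perm.mul_apply, hg.2, ih]
          | pred k ih =>
            rw [← ih, ← hg.2 ((w.1 ^ (-(k : ℤ) - 1)) x), ← Equiv.Perm.mul_apply, ← zpow_one_add]
            congr 3; ring
        exact hinv k
      rw [h₁] at h₃ h₇
      rw [h₇] at h₆
      linarith

end Hyperoctahedral

/-! ### Reflection length and the absolute order -/

namespace Hyperoctahedral

open SignedPt

variable {n : ℕ}

/-- Each reflection lowers the dimension of the fixed space by at most one. -/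
theorem le_length_add_fixDim_prod (l : List (hyperoctahedral n))
    (hl : ∀ t ∈ l, t ∈ reflections n) : n ≤ l.length + fixDim l.prod := by
  induction l with
  | nil => simp [fixDim_one]
  | cons t l ih =>
    have h₁ := ih fun s hs => hl s (List.mem_cons_of_mem _ hs)
    obtain ⟨x, y, -, rfl⟩ := exists_refl_of_mem (hl t List.mem_cons_self)
    have h₂ := fixDim_refl_ge x y
    have h₃ := fixDim_add_le_mul (refl x y) l.prod
    rw [List.length_cons, List.prod_cons]
    omega

/-- The reflection exchanging a moved point `x` with `w x` has its root in the image of `w - 1`. -/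
theorem exists_fixDim_lt {w : hyperoctahedral n} (hw : w ≠ 1) :
    ∃ x y, x ≠ y ∧ fixDim w < fixDim (refl x y * w) := by
  obtain ⟨x, hx⟩ : ∃ x, w.1 x ≠ x := by
    by_contra! h
    exact hw (Subtype.ext (Equiv.ext h))
  exact ⟨x, w.1 x, hx.symm, fixDim_lt_of_movRel hx.symm (movRel_apply w x)⟩

theorem exists_word (hn : 2 ≤ n) (w : hyperoctahedral n) : ∃ l : List (hyperoctahedral n),
    l.length + fixDim w ≤ n ∧ (∀ t ∈ l, t ∈ reflections n) ∧ l.prod = w := by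
  induction h : n - fixDim w using Nat.strong_induction_on generalizing w with
  | _ m ih =>
    by_cases hw : w = 1
    · exact ⟨[], by simpa using fixDim_le w, by simp, by simp [hw]⟩
    · obtain ⟨x, y, hxy, hlt⟩ := exists_fixDim_lt hw
      have hle := fixDim_le (refl x y * w)
      obtain ⟨l, h₁, h₂, h₃⟩ := ih _ (by omega) (refl x y * w) rfl
      refine ⟨refl x y :: l, ?_, ?_, ?_⟩
      · rw [List.length_cons]; omega
      · intro t ht
        rcases List.mem_cons.1 ht with rfl | ht
        · exact refl_mem_reflections hn hxy
        · exact h₂ t ht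
      · rw [List.prod_cons, h₃, ← mul_assoc, refl_mul_self, one_mul]

/-- The reflection length is the codimension of the fixed space. -/
theorem wordLength_add_fixDim (hn : 2 ≤ n) (w : hyperoctahedral n) :
    wordLength (reflections n) w + fixDim w = n := by
  obtain ⟨l, h₁, h₂, h₃⟩ := exists_word hn w
  have hle : wordLength (reflections n) w ≤ l.length := Nat.sInf_le ⟨l, rfl, h₂, h₃⟩
  obtain ⟨l', h₁', h₂', h₃'⟩ := Nat.sInf_mem
    (s := {k | ∃ l : List (hyperoctahedral n), l.length = k ∧ (∀ t ∈ l, t ∈ reflections n) ∧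
      l.prod = w}) ⟨_, l, rfl, h₂, h₃⟩
  have h₄ := le_length_add_fixDim_prod l' h₂'
  rw [h₁', h₃'] at h₄
  change n ≤ wordLength (reflections n) w + fixDim w at h₄
  omega

theorem absLE_iff (hn : 2 ≤ n) {u v : hyperoctahedral n} :
    AbsLE (reflections n) u v ↔ fixDim u + fixDim (u⁻¹ * v) = fixDim v + n := by
  have h₁ := wordLength_add_fixDim hn u
  have h₂ := wordLength_add_fixDim hn v
  have h₃ := wordLength_add_fixDim hn (u⁻¹ * v)
  unfold AbsLE
  omega

/-- In `v = u (u⁻¹ v)` the codimensions add up, and this equality case makes the fixed space of `v`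
an intersection contained in that of `u`. -/
theorem fixOdd_le_of_absLE (hn : 2 ≤ n) {u v : hyperoctahedral n}
    (h : AbsLE (reflections n) u v) : fixOdd v ≤ fixOdd u := by
  rw [absLE_iff hn] at h
  have h' := fixOdd_mul_eq_inf (u := u) (v := u⁻¹ * v) (by rw [mul_inv_cancel_left]; exact h)
  rw [mul_inv_cancel_left] at h'
  rw [h']
  exact inf_le_left

theorem one_absLE (hn : 2 ≤ n) (w : hyperoctahedral n) : AbsLE (reflections n) 1 w := by
  rw [absLE_iff hn, fixDim_one, inv_one, one_mul, add_comm]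

theorem absLE_antisymm (hn : 2 ≤ n) {u v : hyperoctahedral n}
    (h : AbsLE (reflections n) u v) (h' : AbsLE (reflections n) v u) : u = v := by
  rw [absLE_iff hn] at h h'
  have h₁ := fixDim_le (u⁻¹ * v)
  have h₂ := fixDim_le (v⁻¹ * u)
  have := eq_one_of_fixDim (w := u⁻¹ * v) (by omega)
  exact (inv_mul_eq_one.1 this)

theorem fixDim_refl {x y : SignedPt n} (hxy : x ≠ y) : fixDim (refl x y) + 1 = n := by
  have h₁ := fixDim_refl_ge x y
  have h₂ := fixDim_le (refl x y)
  have h₃ : fixDim (refl x y) ≠ n := fun h => hxy <| by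
    have := refl_left x y
    rw [eq_one_of_fixDim h] at this
    exact this
  omega

/-- Multiplication by the reflection raises the fixed dimension by at least one, and subadditivity
of codimension allows no more. -/
theorem refl_absLE_of_movRel (hn : 2 ≤ n) {w : hyperoctahedral n} {x y : SignedPt n}
    (hxy : x ≠ y) (h : MovRel w x y) : AbsLE (reflections n) (refl x y) w := by
  rw [absLE_iff hn, refl_inv]
  have h₁ := fixDim_lt_of_movRel hxy h
  have h₂ := fixDim_refl hxy
  have h₃ := fixDim_add_le_mul (refl x y) (refl x y * w)
  rw [← mul_assoc, refl_mul_self, one_mul] at h₃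
  omega

theorem sameCycle_or_balanced_of_refl_absLE (hn : 2 ≤ n) {w : hyperoctahedral n}
    {x y : SignedPt n} (h : AbsLE (reflections n) (refl x y) w) : w.1.SameCycle x y ∨
      (w.1.SameCycle x (bar x) ∧ w.1.SameCycle y (bar y)) :=
  sameCycle_or_balanced_of_fixOdd_le (fixOdd_le_of_absLE hn h)

theorem fixDim_conj (w v : hyperoctahedral n) : fixDim (w * v * w⁻¹) = fixDim v := by
  have key : ∀ w v : hyperoctahedral n, fixDim v ≤ fixDim (w * v * w⁻¹) := by
    intro w v
    let e : (SignedPt n → ℚ) ≃ₗ[ℚ] (SignedPt n → ℚ) := LinearEquiv.funCongrLeft ℚ ℚ w.1⁻¹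
    have h : (fixOdd v).map e.toLinearMap ≤ fixOdd (w * v * w⁻¹) := by
      rintro _ ⟨g, hg, rfl⟩
      refine ⟨fun x => ?_, fun x => ?_⟩
      · change g ((w⁻¹).1 (bar x)) = -g ((w⁻¹).1 x)
        rw [apply_bar, hg.1]
      · change g (w.1.symm (w.1 (v.1 (w.1.symm x)))) = g (w.1.symm x)
        rw [Equiv.symm_apply_apply, hg.2]
    refine le_trans (le_of_eq ?_) (Submodule.finrank_mono h)
    exact (LinearEquiv.finrank_map_eq e (fixOdd v)).symm
  refine le_antisymm ?_ (key w v)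
  have := key w⁻¹ (w * v * w⁻¹)
  simpa [mul_assoc] using this

theorem fixDim_mul_refl (hn : 2 ≤ n) {v : hyperoctahedral n} {x y : SignedPt n} (hxy : x ≠ y)
    (h : AbsLE (reflections n) (refl x y) v) : fixDim (v * refl x y) = fixDim v + 1 := by
  have h₁ := (absLE_iff hn).1 h
  have h₂ := fixDim_refl hxy
  have h₃ := fixDim_conj (refl x y) (refl x y * v)
  rw [refl_inv] at h₁ h₃
  rw [← mul_assoc, refl_mul_self, one_mul] at h₃
  omega

end Hyperoctahedral

/-! ### Noncrossing partitions, their rotations and cuts along chords -/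

namespace Hyperoctahedral

open SignedPt

variable {n : ℕ}

/-- A noncrossing partition of `±[n]` that is stable under the bar, given as a relation on the
integers by means of `SignedPt.ofInt`. -/
structure IsNC (n : ℕ) (E : ℤ → ℤ → Prop) : Prop where
  rfl' : ∀ x : ℤ, E x x
  symm : ∀ {x y : ℤ}, E x y → E y x
  trans : ∀ {x y z : ℤ}, E x y → E y z → E x z
  shift : ∀ {x y : ℤ}, E x y → E (x + n) (y + n)
  period : ∀ x : ℤ, E x (x + 2 * n)
  noncross : ∀ {a b c d : ℤ}, a < b → b < c → c < d → d < a + 2 * n → E a c → E b d → E a b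

/-- `z` is the first integer after `x` that is related to `x`. -/
def IsNext (E : ℤ → ℤ → Prop) (x z : ℤ) : Prop :=
  x < z ∧ E x z ∧ ∀ y, x < y → y < z → ¬ E x y

/-- `v` rotates each block of `E`. -/
def Rot [NeZero n] (E : ℤ → ℤ → Prop) (v : hyperoctahedral n) : Prop :=
  ∀ x z, IsNext E x z → v.1 (ofInt x) = ofInt z

theorem IsNext.unique {E : ℤ → ℤ → Prop} {x z z' : ℤ} (h : IsNext E x z) (h' : IsNext E x z') :
    z = z' := by
  rcases lt_trichotomy z z' with hz | hz | hz
  · exact absurd h.2.1 (h'.2.2 z h.1 hz)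
  · exact hz
  · exact absurd h'.2.1 (h.2.2 z' h'.1 hz)

theorem IsNext.le {E : ℤ → ℤ → Prop} {x y z : ℤ} (h : IsNext E x z) (hxy : x < y) (hE : E x y) :
    z ≤ y := by
  by_contra! hc
  exact h.2.2 y hxy hc hE

theorem exists_isNext_of_lt {E : ℤ → ℤ → Prop} {x y : ℤ} (hxy : x < y) (hE : E x y) :
    ∃ z, IsNext E x z ∧ z ≤ y := by
  classical
  obtain ⟨z, ⟨h₁, h₂⟩, h₃⟩ := Int.exists_least_of_bdd (P := fun z => x < z ∧ E x z)
    ⟨x, fun z hz => hz.1.le⟩ ⟨y, hxy, hE⟩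
  refine ⟨z, ⟨h₁, h₂, fun w hw hw' hc => ?_⟩, h₃ y ⟨hxy, hE⟩⟩
  have := h₃ w ⟨hw, hc⟩
  omega

namespace IsNC

variable {E : ℤ → ℤ → Prop}

theorem shift_iff (hE : IsNC n E) {x y : ℤ} : E (x + n) (y + n) ↔ E x y := by
  refine ⟨fun h => ?_, hE.shift⟩
  have h₁ := hE.shift h
  have h₂ := hE.period x
  have h₃ := hE.period y
  rw [show x + n + n = x + 2 * n by ring, show y + n + n = y + 2 * n by ring] at h₁
  exact hE.trans h₂ (hE.trans h₁ (hE.symm h₃))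

theorem period_mul (hE : IsNC n E) (x k : ℤ) : E x (x + 2 * n * k) := by
  induction k using Int.induction_on with
  | zero => simpa using hE.rfl' x
  | succ k ih =>
    refine hE.trans ih ?_
    have := hE.period (x + 2 * n * k)
    rwa [show x + 2 * n * k + 2 * n = x + 2 * n * (k + 1) by ring] at this
  | pred k ih =>
    refine hE.trans ih (hE.symm ?_)
    have := hE.period (x + 2 * n * (-k - 1))
    rwa [show x + 2 * n * (-k - 1) + 2 * n = x + 2 * n * (-k) by ring] at this

theorem isNext_shift (hE : IsNC n E) {x z : ℤ} (h : IsNext E x z) :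
    IsNext E (x + n) (z + n) := by
  refine ⟨by linarith [h.1], hE.shift h.2.1, fun y hy hy' hc => ?_⟩
  refine h.2.2 (y - n) (by linarith) (by linarith) ?_
  rw [← hE.shift_iff]
  simpa using hc

theorem isNext_shift_neg (hE : IsNC n E) {x z : ℤ} (h : IsNext E x z) :
    IsNext E (x - n) (z - n) := by
  refine ⟨by linarith [h.1], ?_, fun y hy hy' hc => ?_⟩
  · rw [← hE.shift_iff, sub_add_cancel, sub_add_cancel]
    exact h.2.1
  · refine h.2.2 (y + n) (by linarith) (by linarith) ?_
    have := hE.shift hc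
    rwa [sub_add_cancel] at this

theorem of_ofInt_eq [NeZero n] (hE : IsNC n E) {x y : ℤ}
    (h : (ofInt x : SignedPt n) = ofInt y) : E x y := by
  obtain ⟨k, rfl⟩ := ofInt_eq_iff.1 h
  exact hE.period_mul x k

theorem exists_isNext [NeZero n] (hE : IsNC n E) (x : ℤ) :
    ∃ z, IsNext E x z ∧ z ≤ x + 2 * n :=
  exists_isNext_of_lt (by have := two_mul_pos n; omega) (hE.period x)

/-- The successor map within blocks commutes with the shift by `n` and increases strictly on each
block, so it is injective modulo `2n` and descends to ±[n]. -/
theorem exists_rot [NeZero n] (hE : IsNC n E) : ∃ v : hyperoctahedral n, Rot E v := by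
  choose f hf hf' using hE.exists_isNext
  have hshift : ∀ x, f (x + n) = f x + n := fun x =>
    (hf (x + n)).unique (hE.isNext_shift (hf x))
  have hmono : ∀ x y, x < y → E x y → f x < f y := fun x y hxy h =>
    ((hf x).le hxy h).trans_lt (hf y).1
  obtain ⟨v, hv⟩ := exists_of_lift f hshift fun x y h => by
    obtain ⟨k, hk⟩ := ofInt_eq_iff.1 h
    have hk' : f (x + 2 * n * k) = f x + 2 * n * k := by
      refine (hf _).unique ⟨by linarith [(hf x).1], ?_, fun y hy hy' hc => ?_⟩
      · exact hE.trans (hE.symm (hE.period_mul x k)) (hE.trans (hf x).2.1 (hE.period_mul _ k))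
      · refine (hf x).2.2 (y - 2 * n * k) (by linarith) (by linarith) ?_
        have h₁ := hE.period_mul (y - 2 * n * k) k
        rw [sub_add_cancel] at h₁
        exact hE.trans (hE.period_mul x k) (hE.trans hc (hE.symm h₁))
    rw [← hk'] at hk
    rw [← ofInt_add_mul x k]
    congr 1
    have hxy : E (x + 2 * n * k) y := by
      refine hE.trans (hf _).2.1 ?_
      rw [← hk]
      exact hE.symm (hf y).2.1
    rcases lt_trichotomy (x + 2 * n * k) y with h₁ | h₁ | h₁
    · exact absurd hk (hmono _ _ h₁ hxy).ne'
    · exact h₁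
    · exact absurd hk (hmono _ _ h₁ (hE.symm hxy)).ne
  exact ⟨v, fun x z hz => by rw [hv, hz.unique (hf x)]⟩

end IsNC

section

variable [NeZero n] {E : ℤ → ℤ → Prop} {v : hyperoctahedral n}

theorem Rot.rel (hE : IsNC n E) (hv : Rot E v) {x z : ℤ}
    (h : v.1 (ofInt x) = ofInt z) : E x z := by
  obtain ⟨y, hy, -⟩ := hE.exists_isNext x
  exact hE.trans hy.2.1 (hE.of_ofInt_eq (by rw [← hv x y hy, h]))

/-- The blocks of `E` are the cycles of the permutation that rotates them. -/
theorem Rot.sameCycle_iff (hE : IsNC n E) (hv : Rot E v) {x y : ℤ} :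
    v.1.SameCycle (ofInt x) (ofInt y) ↔ E x y := by
  constructor
  · intro h
    obtain ⟨k, hk⟩ := h.exists_nat_pow_eq
    induction k generalizing y with
    | zero => exact hE.of_ofInt_eq hk
    | succ k ih =>
      rw [pow_succ', Equiv.Perm.mul_apply] at hk
      obtain ⟨z, hz⟩ := ofInt_surjective ((v.1 ^ k) (ofInt x))
      rw [← hz] at hk
      exact hE.trans (ih ⟨k, by simp [hz]⟩ hz.symm) (hv.rel hE hk)
  · have key : ∀ (m : ℕ) (x y : ℤ), y - x = m → E x y →
        v.1.SameCycle (ofInt x) (ofInt y) := by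
      intro m
      induction m using Nat.strong_induction_on with
      | _ m ih =>
        intro x y hm h
        rcases Nat.eq_zero_or_pos m with h0 | h0
        · rw [show y = x by omega]
        · obtain ⟨z, hz, hzy⟩ := exists_isNext_of_lt (by omega) h
          have := hz.1
          have h₁ := ih (y - z).toNat (by omega) z y (by omega) (hE.trans (hE.symm hz.2.1) h)
          rwa [← hv x z hz, Equiv.Perm.sameCycle_apply_left] at h₁
    intro h
    rcases le_total x y with hxy | hxy
    · exact key (y - x).toNat x y (by omega) h
    · exact (key (x - y).toNat y x (by omega) (hE.symm h)).symm

/-- The points of the block of a point fixed by `v`. -/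
theorem Rot.apply_eq_self_iff (hE : IsNC n E) (hv : Rot E v) {x : ℤ} :
    v.1 (ofInt x) = ofInt x ↔ IsNext E x (x + 2 * n) := by
  constructor
  · intro h
    obtain ⟨z, hz, hz'⟩ := hE.exists_isNext x
    have h₁ := hv x z hz
    rw [h, ← ofInt_add_two_mul] at h₁
    have h₂ := hz.1
    have h₃ := two_mul_pos n
    rwa [eq_of_ofInt_eq h₁ (by omega) (by omega)]
  · intro h
    rw [hv _ _ h, ofInt_add_two_mul]

end

/-- The integers in `(i, j]` modulo `2n`. -/
def arc (n : ℕ) (i j x : ℤ) : Prop := ∃ k : ℤ, i + 2 * n * k < x ∧ x ≤ j + 2 * n * k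

/-- Cut the blocks of `E` along the chord from `i` to `j` and along its opposite. -/
def cut (n : ℕ) (i j : ℤ) (E : ℤ → ℤ → Prop) (x y : ℤ) : Prop :=
  E x y ∧ (arc n i j x ↔ arc n i j y) ∧ (arc n i j (x + n) ↔ arc n i j (y + n))

theorem arc_iff {i j x : ℤ} (k : ℤ) (hj : j ≤ i + 2 * n)
    (h₁ : i + 2 * n * k < x) (h₂ : x ≤ i + 2 * n * k + 2 * n) :
    arc n i j x ↔ x ≤ j + 2 * n * k := by
  refine ⟨?_, fun h => ⟨k, h₁, h⟩⟩
  rintro ⟨l, hl, hl'⟩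
  have hn : (0 : ℤ) ≤ n := by positivity
  have h₃ : l ≤ k := by nlinarith
  have h₄ : k ≤ l := by nlinarith
  obtain rfl : l = k := le_antisymm h₃ h₄
  exact hl'

theorem arc_add_two_mul {i j x : ℤ} : arc n i j (x + 2 * n) ↔ arc n i j x := by
  constructor
  · rintro ⟨k, h₁, h₂⟩
    exact ⟨k - 1, by linarith, by linarith⟩
  · rintro ⟨k, h₁, h₂⟩
    exact ⟨k + 1, by linarith, by linarith⟩

theorem arc_add_mul {i j x : ℤ} (k : ℤ) : arc n i j (x + 2 * n * k) ↔ arc n i j x := by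
  constructor
  · rintro ⟨l, h₁, h₂⟩
    exact ⟨l - k, by linarith, by linarith⟩
  · rintro ⟨l, h₁, h₂⟩
    exact ⟨l + k, by linarith, by linarith⟩

/-- Over a window of two turns, membership in the arc becomes a condition in linear inequalities,
which `omega` can decide. -/
theorem arc_iff_two_turns {i j x : ℤ} (hj : j ≤ i + 2 * n) (h₁ : i < x) (h₂ : x ≤ i + 4 * n) :
    arc n i j x ↔ x ≤ j ∨ (i + 2 * n < x ∧ x ≤ j + 2 * n) := by
  by_cases h : x ≤ i + 2 * n
  · rw [arc_iff 0 hj (by omega) (by omega)]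
    omega
  · rw [arc_iff 1 hj (by omega) (by omega)]
    omega

/-- Translating `a` into `(i, i + 2n]` puts all four points into a window of two turns; what remains
is linear arithmetic. -/
theorem arc_noncross [NeZero n] {i j : ℤ} (hj : j ≤ i + 2 * n) {a b c d : ℤ}
    (hab : a < b) (hbc : b < c) (hcd : c < d) (hda : d < a + 2 * n)
    (hac : arc n i j a ↔ arc n i j c) (hbd : arc n i j b ↔ arc n i j d) :
    arc n i j a ↔ arc n i j b := by
  obtain ⟨k, hk, hk'⟩ : ∃ k : ℤ, i < a + 2 * n * k ∧ a + 2 * n * k ≤ i + 2 * n := by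
    obtain ⟨x, h₁, h₂, h₃⟩ := exists_ofInt_window (n := n) (i + 1) (ofInt a)
    obtain ⟨k, rfl⟩ := ofInt_eq_iff.1 h₃.symm
    exact ⟨k, by omega, by omega⟩
  rw [← arc_add_mul k, ← arc_add_mul (x := c) k] at hac
  rw [← arc_add_mul k, ← arc_add_mul (x := d) k] at hbd
  rw [← arc_add_mul k, ← arc_add_mul (x := b) k]
  generalize 2 * (n : ℤ) * k = m at *
  rw [arc_iff_two_turns hj (by omega) (by omega), arc_iff_two_turns hj (by omega) (by omega)]
    at hac hbd ⊢
  omega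

theorem isNC_cut [NeZero n] {E : ℤ → ℤ → Prop} (hE : IsNC n E) {i j : ℤ}
    (hj : j ≤ i + 2 * n) : IsNC n (cut n i j E) where
  rfl' x := ⟨hE.rfl' x, Iff.rfl, Iff.rfl⟩
  symm h := ⟨hE.symm h.1, h.2.1.symm, h.2.2.symm⟩
  trans h h' := ⟨hE.trans h.1 h'.1, h.2.1.trans h'.2.1, h.2.2.trans h'.2.2⟩
  shift {x y} h := ⟨hE.shift h.1, h.2.2, by
    rw [add_assoc, add_assoc, ← two_mul, arc_add_two_mul, arc_add_two_mul]
    exact h.2.1⟩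
  period x := ⟨hE.period x, arc_add_two_mul.symm, by
    rw [add_right_comm, arc_add_two_mul]⟩
  noncross hab hbc hcd hda h h' := ⟨hE.noncross hab hbc hcd hda h.1 h'.1,
    arc_noncross hj hab hbc hcd hda h.2.1 h'.2.1,
    arc_noncross hj (by omega) (by omega) (by omega) (by omega) h.2.2 h'.2.2⟩

theorem cut_mono {E E' : ℤ → ℤ → Prop} (h : ∀ x y, E x y → E' x y) (i j : ℤ) :
    ∀ x y, cut n i j E x y → cut n i j E' x y :=
  fun x y hxy => ⟨h x y hxy.1, hxy.2⟩

theorem isNC_true : IsNC n fun _ _ => True where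
  rfl' _ := trivial
  symm _ := trivial
  trans _ _ := trivial
  shift _ := trivial
  period _ := trivial
  noncross _ _ _ _ _ _ := trivial

theorem rot_true [NeZero n] : Rot (fun _ _ => True) (coxeterElement n) := by
  intro x z hz
  rw [coxeterElement_ofInt]
  congr 1
  have h₁ := hz.1
  have h₂ := hz.le (y := x + 1) (by omega) trivial
  omega

end Hyperoctahedral

/-! ### Multiplication by a reflection cuts blocks -/

namespace Hyperoctahedral

open SignedPt

variable {n : ℕ} [NeZero n] {E : ℤ → ℤ → Prop} {v : hyperoctahedral n}

theorem exists_window_half (i x : ℤ) : ∃ y k : ℤ, i < y ∧ y ≤ i + n ∧ x = y + n * k := by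
  have hn : (0 : ℤ) < n := by exact_mod_cast NeZero.pos n
  refine ⟨i + 1 + (x - i - 1) % n, (x - i - 1) / n, ?_, ?_, ?_⟩
  · have := Int.emod_nonneg (x - i - 1) hn.ne'
    omega
  · have := Int.emod_lt_of_pos (x - i - 1) hn
    omega
  · have := Int.emod_add_mul_ediv (x - i - 1) n
    linarith

theorem ofInt_sub_self (x : ℤ) : (ofInt (x - n) : SignedPt n) = bar (ofInt x) := by
  rw [← bar_eq_iff, ← ofInt_add_self, sub_add_cancel]

/-- By symmetry, the rotation property has to be checked on a half turn only. -/
theorem rot_of_half (hE : IsNC n E) (i : ℤ)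
    (h : ∀ x, i < x → x ≤ i + n → ∃ z, IsNext E x z ∧ v.1 (ofInt x) = ofInt z) : Rot E v := by
  have key : ∀ x, ∃ z, IsNext E x z ∧ v.1 (ofInt x) = ofInt z := by
    intro x
    obtain ⟨y, k, h₁, h₂, rfl⟩ := exists_window_half (n := n) i x
    induction k using Int.induction_on with
    | zero => simpa using h y h₁ h₂
    | succ k ih =>
      obtain ⟨z, hz, hz'⟩ := ih
      refine ⟨z + n, ?_, ?_⟩
      · convert hE.isNext_shift hz using 1
        ring
      · rw [mul_add, mul_one, ← add_assoc, ofInt_add_self, ofInt_add_self, apply_bar, hz']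
    | pred k ih =>
      obtain ⟨z, hz, hz'⟩ := ih
      refine ⟨z - n, ?_, ?_⟩
      · convert hE.isNext_shift_neg hz using 1
        ring
      · rw [mul_sub, mul_one, ← add_sub_assoc, ofInt_sub_self, ofInt_sub_self, apply_bar, hz']
  intro x z hz
  obtain ⟨z', h₁, h₂⟩ := key x
  rw [h₂, h₁.unique hz]

/-- Multiplication by the reflection of a chord inside a block cuts the block. -/
theorem rot_cut (hE : IsNC n E) (hv : Rot E v) {i j : ℤ} (hij : i < j) (hj : j ≤ i + n)
    (h : E i j) : Rot (cut n i j E) (v * refl (ofInt i) (ofInt j)) := by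
  have hn := two_mul_pos n
  have hj2 : j ≤ i + 2 * n := by omega
  have hij1 : E (i + n) (j + n) := hE.shift h
  have hij2 : E (i + 2 * n) (j + 2 * n) :=
    hE.trans (hE.symm (hE.period i)) (hE.trans h (hE.period j))
  refine rot_of_half (isNC_cut hE hj2) i fun x hx hx' => ?_
  change ∃ z, _ ∧ v.1 ((refl (ofInt i) (ofInt j)).1 (ofInt x)) = _
  -- In the half turn `(i, i + n]` only `i + n` and `j` can be moved by the reflection. Because the
  -- arc is `(i, j]`, the point `j` belongs to it and `i` does not, which matches `i ↦ next j` and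
  -- `j ↦ next i`. The case `j = i + n` falls under `x = i + n`.
  by_cases hxi : x = i + n
  · subst hxi
    obtain ⟨z, hz, -⟩ := hE.exists_isNext (j + n)
    have hzlt := hz.1
    have hzE : E (i + n) z := hE.trans hij1 hz.2.1
    have hzle : z ≤ i + n + 2 * n :=
      hz.le (by omega) (hE.trans (hE.symm hij1) (hE.period _))
    refine ⟨z, ⟨by omega, ⟨hzE, ?_, ?_⟩, fun y hy hy' hc => ?_⟩, ?_⟩
    · rw [arc_iff_two_turns hj2 (by omega) (by omega),
        arc_iff_two_turns hj2 (by omega) (by omega)]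
      by_cases hjn : j = i + n
      · omega
      -- A successor beyond `i + 2n` would cross the chord from `i + 2n` to `j + 2n`, which would
      -- put `i + 2n` itself into the block as an earlier successor.
      · have : ¬ (i + 2 * n < z ∧ z ≤ j + 2 * n) := by
          rintro ⟨h₁, h₂⟩
          have h₃ : E (i + n) (i + 2 * n) := by
            rcases h₂.lt_or_eq with h₂ | rfl
            · exact hE.noncross (by omega) h₁ h₂ (by omega) hzE hij2
            · exact hE.trans hzE (hE.symm hij2)
          exact hz.2.2 (i + 2 * n) (by omega) h₁ (hE.trans (hE.symm hij1) h₃)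
        omega
    · rw [arc_iff_two_turns hj2 (by omega) (by omega),
        arc_iff_two_turns hj2 (by omega) (by omega)]
      omega
    · have h₁ : ¬ j + n < y := fun h₁ => hz.2.2 y h₁ hy' (hE.trans (hE.symm hij1) hc.1)
      have h₂ := hc.2.2
      rw [arc_iff_two_turns hj2 (by omega) (by omega),
        arc_iff_two_turns hj2 (by omega) (by omega)] at h₂
      omega
    · rw [ofInt_add_self, apply_bar, refl_left, ← ofInt_add_self]
      exact hv _ _ hz
  by_cases hxj : x = j
  · subst hxj
    obtain ⟨z, hz, -⟩ := hE.exists_isNext i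
    have hzlt := hz.1
    have hzle : z ≤ x := hz.le hij h
    refine ⟨z + 2 * n, ⟨by omega,
      ⟨hE.trans (hE.symm h) (hE.trans hz.2.1 (hE.period z)), ?_, ?_⟩, fun y hy hy' hc => ?_⟩, ?_⟩
    · rw [arc_iff_two_turns hj2 (by omega) (by omega),
        arc_iff_two_turns hj2 (by omega) (by omega)]
      omega
    · rw [arc_iff_two_turns hj2 (by omega) (by omega),
        arc_iff_two_turns hj2 (by omega) (by omega)]
      omega
    · have h₂ := hc.2.1
      rw [arc_iff_two_turns hj2 (by omega) (by omega),
        arc_iff_two_turns hj2 (by omega) (by omega)] at h₂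
      refine hz.2.2 (y - 2 * n) (by omega) (by omega) ?_
      have h₃ := hE.period (y - 2 * n)
      rw [sub_add_cancel] at h₃
      exact hE.trans h (hE.trans hc.1 (hE.symm h₃))
    · rw [refl_right, ofInt_add_two_mul]
      exact hv _ _ hz
  have hfix : (refl (ofInt i) (ofInt j)).1 (ofInt x) = (ofInt x : SignedPt n) := by
    refine refl_of_ne (fun hc => ?_) (fun hc => ?_) (fun hc => ?_) (fun hc => ?_)
    · have := eq_of_ofInt_eq hc (by omega) (by omega)
      omega
    · have := eq_of_ofInt_eq hc (by omega) (by omega)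
      omega
    · rw [← ofInt_add_self] at hc
      have := eq_of_ofInt_eq hc (by omega) (by omega)
      omega
    · rw [← ofInt_add_self] at hc
      have := eq_of_ofInt_eq hc (by omega) (by omega)
      omega
  rw [hfix]
  obtain ⟨z, hz, hzle⟩ := hE.exists_isNext x
  have hzlt := hz.1
  refine ⟨z, ⟨hzlt, ⟨hz.2.1, ?_⟩, fun y hy hy' hc => hz.2.2 y hy hy' hc.1⟩, hv _ _ hz⟩
  rw [arc_iff_two_turns hj2 (by omega) (by omega), arc_iff_two_turns hj2 (by omega) (by omega),
    arc_iff_two_turns hj2 (by omega) (by omega), arc_iff_two_turns hj2 (by omega) (by omega)]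
  -- Any other point keeps its successor. If that successor lay on another side of a chord,
  -- noncrossing would make a chord endpoint an earlier successor.
  by_cases hxlt : x < j
  · have : ¬ (j < z ∧ z ≤ i + 2 * n) := by
      rintro ⟨h₁, h₂⟩
      have h₃ : E i x := by
        rcases h₂.lt_or_eq with h₂ | rfl
        · exact hE.noncross hx hxlt h₁ h₂ h hz.2.1
        · exact hE.trans (hE.period i) (hE.symm hz.2.1)
      exact hz.2.2 j hxlt h₁ (hE.trans (hE.symm h₃) h)
    omega
  · have h₁ : ¬ (i + 2 * n < z ∧ z ≤ j + 2 * n) := by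
      rintro ⟨h₁, h₂⟩
      refine hz.2.2 (i + 2 * n) (by omega) h₁ ?_
      rcases h₂.lt_or_eq with h₂ | rfl
      · exact hE.noncross (by omega) h₁ h₂ (by omega) hz.2.1 hij2
      · exact hE.trans hz.2.1 (hE.symm hij2)
    have h₂ : ¬ (i + n < z ∧ z ≤ j + n) := by
      rintro ⟨h₁, h₂⟩
      refine hz.2.2 (i + n) (by omega) h₁ ?_
      rcases h₂.lt_or_eq with h₂ | rfl
      · exact hE.noncross (by omega) h₁ h₂ (by omega) hz.2.1 hij1
      · exact hE.trans hz.2.1 (hE.symm hij1)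
    omega

end Hyperoctahedral

/-! ### The interval [e, c] and the projection as a noncrossing closure -/

namespace Hyperoctahedral

open SignedPt

variable {n : ℕ} [NeZero n] {E : ℤ → ℤ → Prop} {v : hyperoctahedral n}

/-- Two diameters always cross, so at most one block is stable under the bar. -/
theorem IsNC.rel_of_balanced (hE : IsNC n E) {a b : ℤ} (ha : E a (a + n)) (hb : E b (b + n)) :
    E a b := by
  obtain ⟨y, k, h₁, h₂, rfl⟩ := exists_window_half (n := n) a b
  have hshift : ∀ k : ℤ, E (y + n * k) (y + n * k + n) → E y (y + n * k) := by
    intro k hk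
    have h : E y (y + n) := by
      induction k using Int.induction_on with
      | zero => simpa using hk
      | succ k ih =>
        refine ih ?_
        rw [← hE.shift_iff]
        rwa [mul_add, mul_one, ← add_assoc] at hk
      | pred k ih =>
        refine ih ?_
        rw [mul_sub, mul_one, ← add_sub_assoc] at hk
        have := hE.shift hk
        rwa [sub_add_cancel] at this
    induction k using Int.induction_on with
    | zero => simpa using hE.rfl' y
    | succ k ih =>
      have h' : E (y + n * k) (y + n * k + n) := by
        rw [← hE.shift_iff]
        rwa [mul_add, mul_one, ← add_assoc] at hk
      have := hE.trans (ih h') h'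
      rwa [mul_add, mul_one, ← add_assoc]
    | pred k ih =>
      rw [mul_sub, mul_one, ← add_sub_assoc] at hk ⊢
      have h₃ := hE.shift hk
      rw [sub_add_cancel] at h₃ hk
      exact hE.trans (ih h₃) (hE.symm hk)
  have hy := hshift k hb
  refine hE.trans ?_ hy
  have hyn : E y (y + n) := by
    have h₃ := hE.shift hy
    exact hE.trans hy (hE.trans hb (hE.symm h₃))
  have hn := two_mul_pos n
  rcases h₂.lt_or_eq with h₂ | rfl
  · exact hE.noncross h₁ h₂ (by omega) (by omega) ha hyn
  · exact ha

theorem Rot.rel_of_fixOdd_le (hE : IsNC n E) (hv : Rot E v) {a b : ℤ}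
    (h : fixOdd v ≤ fixOdd (refl (ofInt a) (ofInt b))) : E a b := by
  rcases sameCycle_or_balanced_of_fixOdd_le h with h | ⟨h₁, h₂⟩
  · exact (hv.sameCycle_iff hE).1 h
  · rw [← ofInt_add_self, hv.sameCycle_iff hE] at h₁ h₂
    exact hE.rel_of_balanced h₁ h₂

theorem Rot.refl_absLE (hn : 2 ≤ n) (hE : IsNC n E) (hv : Rot E v) {a b : ℤ}
    (hab : (ofInt a : SignedPt n) ≠ ofInt b) (h : E a b) :
    AbsLE (reflections n) (refl (ofInt a) (ofInt b)) v :=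
  refl_absLE_of_movRel hn hab (movRel_of_sameCycle ((hv.sameCycle_iff hE).2 h))

/-- A chord has a representative that spans at most a half turn. -/
theorem IsNC.exists_short_chord {P : ℤ → ℤ → Prop} (hP : IsNC n P) {a b : ℤ}
    (hab : (ofInt a : SignedPt n) ≠ ofInt b) (h : P a b) : ∃ i j : ℤ, i < j ∧ j ≤ i + n ∧ P i j ∧
      refl (ofInt a) (ofInt b) = (refl (ofInt i) (ofInt j) : hyperoctahedral n) := by
  obtain ⟨j, h₁, h₂, h₃⟩ := exists_ofInt_window (n := n) a (ofInt b)
  have hne : a ≠ j := fun he => hab (by rw [he, h₃])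
  have haj : P a j := hP.trans h (hP.of_ofInt_eq h₃.symm)
  by_cases hj : j ≤ a + n
  · exact ⟨a, j, by omega, hj, haj, by rw [h₃]⟩
  · refine ⟨j - 2 * n, a, by omega, by omega, ?_, ?_⟩
    · have := hP.period (j - 2 * n)
      rw [sub_add_cancel] at this
      exact hP.trans this (hP.symm haj)
    · rw [← ofInt_add_two_mul (j - 2 * n), sub_add_cancel, h₃, refl_comm]

/-- Refinement of noncrossing partitions implies the absolute order. -/
theorem absLE_of_refines (hn : 2 ≤ n) {P Q : ℤ → ℤ → Prop} (hP : IsNC n P) (hQ : IsNC n Q)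
    (hPQ : ∀ x y, P x y → Q x y) {u v : hyperoctahedral n} (hu : Rot P u) (hv : Rot Q v) :
    AbsLE (reflections n) u v := by
  induction hm : n - fixDim u using Nat.strong_induction_on generalizing P Q u v with
  | _ m ih =>
    by_cases hu1 : u = 1
    · rw [hu1]
      exact one_absLE hn v
    obtain ⟨x, hx⟩ : ∃ x, u.1 x ≠ x := by
      by_contra! h
      exact hu1 (Subtype.ext (Equiv.ext h))
    obtain ⟨a, rfl⟩ := ofInt_surjective x
    obtain ⟨b, hb⟩ := ofInt_surjective (u.1 (ofInt a))
    -- A chord inside a block of `P` also lies inside a block of `Q`. Cutting both partitions along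
    -- it preserves refinement and multiplies `u` and `v` by the same reflection, with `u` becoming
    -- shorter.
    obtain ⟨i, j, hij, hj, hPij, -⟩ :=
      hP.exists_short_chord (fun h => hx (by rw [← hb, h])) (hu.rel hP hb.symm)
    have hne : (ofInt i : SignedPt n) ≠ ofInt j := fun h => by
      have := two_mul_pos n
      have := eq_of_ofInt_eq h (by omega) (by omega)
      omega
    have h₁ := fixDim_mul_refl hn hne (hu.refl_absLE hn hP hne hPij)
    have h₂ := fixDim_mul_refl hn hne (hv.refl_absLE hn hQ hne (hPQ _ _ hPij))
    have h₃ := fixDim_le (u * refl (ofInt i) (ofInt j))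
    have h₄ := ih _ (by omega) (isNC_cut hP (by omega)) (isNC_cut hQ (by omega))
      (cut_mono hPQ i j) (rot_cut hP hu hij hj hPij) (rot_cut hQ hv hij hj (hPQ _ _ hPij)) rfl
    rw [absLE_iff hn] at h₄ ⊢
    -- With `t` the reflection, `(u t)⁻¹ (v t)` is a conjugate of `u⁻¹ v`.
    have h₅ := fixDim_conj (refl (ofInt i) (ofInt j))⁻¹ (u⁻¹ * v)
    rw [inv_inv] at h₅
    rw [mul_inv_rev] at h₄
    simp only [mul_assoc] at h₄ h₅
    omega

/-- Every element of `[e, c]` rotates the blocks of a noncrossing partition. -/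
theorem exists_isNC_of_absLE (hn : 2 ≤ n) {u : hyperoctahedral n}
    (h : AbsLE (reflections n) u (coxeterElement n)) : ∃ P, IsNC n P ∧ Rot P u := by
  induction hm : n - fixDim (u⁻¹ * coxeterElement n) using Nat.strong_induction_on
    generalizing u with
  | _ m ih =>
    by_cases hu : u⁻¹ * coxeterElement n = 1
    · rw [inv_mul_eq_one] at hu
      rw [hu]
      exact ⟨_, isNC_true, rot_true⟩
    -- The induction descends from `c`: a reflection `t` that shortens `u⁻¹ c` gives a longer
    -- element `u t` of the interval, and `u` is recovered from `u t` by a cut.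
    obtain ⟨x, y, hxy, hlt⟩ := exists_fixDim_lt hu
    have h₁ := (absLE_iff hn).1 h
    have h₂ := fixDim_refl hxy
    have h₃ := fixDim_add_le_mul u (refl x y)
    have h₄ := fixDim_add_le_mul (u * refl x y) ((u * refl x y)⁻¹ * coxeterElement n)
    have h₅ := fixDim_le (refl x y * (u⁻¹ * coxeterElement n))
    have h₆ := fixDim_add_le_mul (refl x y) (refl x y * (u⁻¹ * coxeterElement n))
    rw [← mul_assoc (refl x y) (refl x y), refl_mul_self, one_mul] at h₆
    have he : (u * refl x y)⁻¹ * coxeterElement n = refl x y * (u⁻¹ * coxeterElement n) := by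
      rw [mul_inv_rev, refl_inv, mul_assoc]
    rw [mul_inv_cancel_left, he] at h₄
    obtain ⟨P, hP, hrot⟩ := ih (n - fixDim (refl x y * (u⁻¹ * coxeterElement n))) (by omega)
      (u := u * refl x y) (by rw [absLE_iff hn, he]; omega) (by rw [he])
    obtain ⟨a, rfl⟩ := ofInt_surjective x
    obtain ⟨b, rfl⟩ := ofInt_surjective y
    -- The lengths of `u` and the reflection add up, so invariants of the product are invariants of
    -- the reflection. Hence its chord lies inside a block of `P`.
    have hle : fixOdd (u * refl (ofInt a) (ofInt b)) ≤ fixOdd (refl (ofInt a) (ofInt b)) := by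
      rw [fixOdd_mul_eq_inf (by omega)]
      exact inf_le_right
    obtain ⟨i, j, hij, hj, hPij, hr⟩ :=
      hP.exists_short_chord hxy (hrot.rel_of_fixOdd_le hP hle)
    have h₇ := rot_cut hP hrot hij hj hPij
    rw [← hr, mul_assoc, refl_mul_self, mul_one] at h₇
    exact ⟨_, isNC_cut hP (by omega), h₇⟩

/-- The finest noncrossing partition that is coarser than the cycle partition of `w`. -/
def ncClosure (w : hyperoctahedral n) (x y : ℤ) : Prop :=
  ∀ P, IsNC n P → (∀ a b, w.1 (ofInt a) = ofInt b → P a b) → P x y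

theorem isNC_ncClosure (w : hyperoctahedral n) : IsNC n (ncClosure w) where
  rfl' x := fun _ hP _ => hP.rfl' x
  symm h := fun P hP hw => hP.symm (h P hP hw)
  trans h h' := fun P hP hw => hP.trans (h P hP hw) (h' P hP hw)
  shift h := fun P hP hw => hP.shift (h P hP hw)
  period x := fun _ hP _ => hP.period x
  noncross hab hbc hcd hda h h' := fun P hP hw =>
    hP.noncross hab hbc hcd hda (h P hP hw) (h' P hP hw)

theorem ncClosure_of_apply {w : hyperoctahedral n} {a b : ℤ} (h : w.1 (ofInt a) = ofInt b) :
    ncClosure w a b := fun _ _ hw => hw a b h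

theorem IsNC.rel_of_sameCycle {P : ℤ → ℤ → Prop} (hP : IsNC n P) {w : hyperoctahedral n}
    (hw : ∀ a b, w.1 (ofInt a) = ofInt b → P a b) {a b : ℤ}
    (h : w.1.SameCycle (ofInt a) (ofInt b)) : P a b := by
  obtain ⟨k, hk⟩ := h.exists_nat_pow_eq
  clear h
  induction k generalizing b with
  | zero => exact hP.of_ofInt_eq hk
  | succ k ih =>
    rw [pow_succ', Equiv.Perm.mul_apply] at hk
    obtain ⟨z, hz⟩ := ofInt_surjective ((w.1 ^ k) (ofInt a))
    rw [← hz] at hk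
    exact hP.trans (ih hz.symm) (hw _ _ hk)

/-- A reflection below `w` joins points of one cycle or of two balanced cycles, hence points of one
block of the closure; so `v` is an upper bound. It is the least one because the reflection
exchanging a moved point `p` with `w p` lies below `w`: the partition of any upper bound must
therefore contain the cycles of `w`. -/
theorem isNoncrossingJoin_of_rot (hn : 2 ≤ n) {w : hyperoctahedral n}
    (hv : Rot (ncClosure w) v) :
    IsNoncrossingJoin (reflections n) (coxeterElement n) w v := by
  have hE := isNC_ncClosure w
  refine ⟨⟨one_absLE hn v,
    absLE_of_refines hn hE isNC_true (fun _ _ _ => trivial) hv rot_true⟩, ?_, ?_⟩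
  · intro t ht htw
    obtain ⟨x, y, hxy, rfl⟩ := exists_refl_of_mem ht
    obtain ⟨a, rfl⟩ := ofInt_surjective x
    obtain ⟨b, rfl⟩ := ofInt_surjective y
    refine hv.refl_absLE hn hE hxy ?_
    have hw := fun a b => ncClosure_of_apply (w := w) (a := a) (b := b)
    rcases sameCycle_or_balanced_of_refl_absLE hn htw with h | ⟨h₁, h₂⟩
    · exact hE.rel_of_sameCycle hw h
    · rw [← ofInt_add_self] at h₁ h₂
      exact hE.rel_of_balanced (hE.rel_of_sameCycle hw h₁) (hE.rel_of_sameCycle hw h₂)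
  · intro u hu hle
    obtain ⟨P, hP, hrot⟩ := exists_isNC_of_absLE hn hu.2
    refine absLE_of_refines hn hE hP (fun x y hxy => hxy P hP fun a b hab => ?_) hv hrot
    by_cases hne : (ofInt a : SignedPt n) = ofInt b
    · exact hP.of_ofInt_eq hne
    refine hrot.rel_of_fixOdd_le hP (fixOdd_le_of_absLE hn ?_)
    refine hle _ (refl_mem_reflections hn hne) (refl_absLE_of_movRel hn hne ?_)
    rw [← hab]
    exact movRel_apply w _

/-- The noncrossing projection rotates the blocks of the noncrossing closure. -/
theorem rot_piT (hn : 2 ≤ n) (w : hyperoctahedral n) : Rot (ncClosure w) (piT w) := by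
  obtain ⟨v, hv⟩ := (isNC_ncClosure w).exists_rot
  have hj := isNoncrossingJoin_of_rot hn hv
  have hex : ∃ v, IsNoncrossingJoin (reflections n) (coxeterElement n) w v := ⟨v, hj⟩
  have hpi : piT w = hex.choose := dif_pos hex
  have hc := hex.choose_spec
  rw [← hpi] at hc
  have : piT w = v := absLE_antisymm hn (hc.2.2 v hj.1 hj.2.1) (hj.2.2 _ hc.1 hc.2.1)
  rwa [this]

/-- The partition into the two singletons of a fixed point and its bar, with all other points in one
block, is noncrossing and contains the cycles of `w`. -/
theorem ofInt_eq_of_ncClosure {w : hyperoctahedral n} {x y : ℤ} (hx : w.1 (ofInt x) = ofInt x)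
    (h : ncClosure w x y) : (ofInt x : SignedPt n) = ofInt y := by
  let Z : ℤ → Prop := fun a => (ofInt a : SignedPt n) = ofInt x ∨ (ofInt a : SignedPt n) =
    bar (ofInt x)
  have hZ : ∀ a, Z a → Z (a + n) := by
    rintro a (ha | ha)
    · exact Or.inr (by rw [ofInt_add_self, ha])
    · exact Or.inl (by rw [ofInt_add_self, ha, bar_bar])
  have hZ' : ∀ a, Z (a + n) → Z a := by
    intro a ha
    have := hZ _ ha
    simp only [Z] at this ⊢
    rwa [add_assoc, ← two_mul, ofInt_add_two_mul] at this
  have hZc : ∀ a b, (ofInt a : SignedPt n) = ofInt b → Z a → Z b := by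
    intro a b hab ha
    simp only [Z] at ha ⊢
    rwa [← hab]
  have hn := two_mul_pos n
  have hP : IsNC n fun a b => (ofInt a : SignedPt n) = ofInt b ∨ (¬ Z a ∧ ¬ Z b) :=
    { rfl' := fun a => Or.inl rfl
      symm := by
        rintro a b (h | h)
        · exact Or.inl h.symm
        · exact Or.inr h.symm
      trans := by
        rintro a b c (h | h) (h' | h')
        · exact Or.inl (h.trans h')
        · exact Or.inr ⟨fun ha => h'.1 (hZc _ _ h ha), h'.2⟩
        · exact Or.inr ⟨h.1, fun hc => h.2 (hZc _ _ h'.symm hc)⟩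
        · exact Or.inr ⟨h.1, h'.2⟩
      shift := by
        rintro a b (h | h)
        · exact Or.inl (by rw [ofInt_add_self, ofInt_add_self, h])
        · exact Or.inr ⟨fun ha => h.1 (hZ' _ ha), fun hb => h.2 (hZ' _ hb)⟩
      period := fun a => Or.inl (ofInt_add_two_mul a).symm
      noncross := by
        rintro a b c d hab hbc hcd hda (h | h) (h' | h')
        · exact absurd (eq_of_ofInt_eq h (by omega) (by omega)) (by omega)
        · exact absurd (eq_of_ofInt_eq h (by omega) (by omega)) (by omega)
        · exact absurd (eq_of_ofInt_eq h' (by omega) (by omega)) (by omega)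
        · exact Or.inr ⟨h.1, h'.1⟩ }
  have hfix : ∀ a, Z a → w.1 (ofInt a) = ofInt a := by
    rintro a (ha | ha)
    · rw [ha, hx]
    · rw [ha, apply_bar, hx]
  have hw : ∀ a b, w.1 (ofInt a) = ofInt b →
      (ofInt a : SignedPt n) = ofInt b ∨ (¬ Z a ∧ ¬ Z b) := by
    intro a b hab
    by_cases ha : Z a
    · exact Or.inl (by rw [← hab, hfix a ha])
    · refine Or.inr ⟨ha, fun hb => ha (hZc b a ?_ hb)⟩
      exact w.1.injective (by rw [hfix b hb, hab])
  exact (h _ hP hw).resolve_right fun h' => h'.1 (Or.inl rfl)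

/-- The projection has the same fixed points as `w`. -/
theorem piT_apply_eq_self_iff (hn : 2 ≤ n) {w : hyperoctahedral n} {p : SignedPt n} :
    (piT w).1 p = p ↔ w.1 p = p := by
  have hE := isNC_ncClosure w
  have hv := rot_piT hn w
  obtain ⟨x, rfl⟩ := ofInt_surjective p
  constructor
  · intro h
    obtain ⟨y, h₁, h₂, h₃⟩ := exists_ofInt_window (n := n) (x + 1) (w.1 (ofInt x))
    have h₄ := ((hv.apply_eq_self_iff hE).1 h).le (by omega) (ncClosure_of_apply h₃.symm)
    rw [← h₃, show y = x + 2 * n by omega, ofInt_add_two_mul]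
  · intro h
    obtain ⟨y, hy⟩ := ofInt_surjective ((piT w).1 (ofInt x))
    rw [← hy, ← ofInt_eq_of_ncClosure h (hv.rel hE hy.symm)]

end Hyperoctahedral

/-! ### Loss of antiexceedances along an orbit -/

theorem forwardOrbit_eq_insert {X : Type*} (f : X → X) (x : X) :
    forwardOrbit f x = insert x (forwardOrbit f (f x)) := by
  ext y
  simp only [forwardOrbit, Set.mem_range, Set.mem_insert_iff]
  constructor
  · rintro ⟨k, rfl⟩
    rcases k with _ | k
    · exact Or.inl rfl
    · exact Or.inr ⟨k, rfl⟩
  · rintro (rfl | ⟨k, rfl⟩)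
    · exact ⟨0, rfl⟩
    · exact ⟨k + 1, rfl⟩

namespace Hyperoctahedral

open SignedPt

variable {n : ℕ}

theorem pop_inv_apply (w : hyperoctahedral n) (p : SignedPt n) :
    (pop w).1⁻¹ p = (piT w).1 (w.1⁻¹ p) := by
  rfl

variable [NeZero n] {E : ℤ → ℤ → Prop} {v : hyperoctahedral n}

theorem Rot.lt_and_le_of_lt (hE : IsNC n E) (hv : Rot E v) {p q : SignedPt n}
    (h : v.1.SameCycle p q) (hpq : p < q) : p < v.1 p ∧ v.1 p ≤ q := by
  obtain ⟨x, hx, hx', rfl⟩ := exists_ofInt_window (n := n) 0 p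
  obtain ⟨y, hy, hy', rfl⟩ := exists_ofInt_window (n := n) 0 q
  rw [zero_add] at hx' hy'
  rw [ofInt_lt_iff hx hx' hy hy'] at hpq
  obtain ⟨z, hz, hzy⟩ := exists_isNext_of_lt hpq ((hv.sameCycle_iff hE).1 h)
  have := hz.1
  rw [hv x z hz, ofInt_lt_iff hx hx' (by omega) (by omega), ← not_lt,
    ofInt_lt_iff hy hy' (by omega) (by omega)]
  omega

/-- The maximum of a block wraps around to its minimum. -/
theorem Rot.le_of_isMax (hE : IsNC n E) (hv : Rot E v) {p q : SignedPt n}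
    (hp : ∀ q, v.1.SameCycle p q → q ≤ p) (h : v.1.SameCycle p q) : v.1 p ≤ q := by
  obtain ⟨x, hx, hx', rfl⟩ := exists_ofInt_window (n := n) 0 p
  obtain ⟨y, hy, hy', rfl⟩ := exists_ofInt_window (n := n) 0 q
  rw [zero_add] at hx' hy'
  obtain ⟨z, hz, hzx⟩ := hE.exists_isNext x
  have h₁ := hz.1
  have h₂ : 2 * n ≤ z := by
    by_contra! hc
    have h₃ := hp (ofInt z) ((hv.sameCycle_iff hE).2 hz.2.1)
    rw [← not_lt, ofInt_lt_iff hx hx' (by omega) (by omega)] at h₃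
    omega
  have h₃ : z ≤ y + 2 * n :=
    hz.le (by omega) (hE.trans ((hv.sameCycle_iff hE).1 h) (hE.period y))
  rw [hv x z hz, ← sub_add_cancel z (2 * n), ofInt_add_two_mul, ← not_lt,
    ofInt_lt_iff hy hy' (by omega) (by omega)]
  omega

theorem Rot.isMax_of_apply_le (hE : IsNC n E) (hv : Rot E v) {p q : SignedPt n}
    (hp : v.1 p ≤ p) (h : v.1.SameCycle p q) : q ≤ p := by
  by_contra! hc
  exact absurd (hv.lt_and_le_of_lt hE h hc).1 (not_lt.2 hp)

/-- A rotation has one descent in each nontrivial cycle. -/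
theorem Rot.card_descents (hE : IsNC n E) (hv : Rot E v) :
    (Finset.univ.filter fun y : SignedPt n => v.1 y < y).card = cyc v := by
  refine Finset.card_bij (fun y _ => v.1.cycleOf y) ?_ ?_ ?_
  · intro y hy
    rw [Equiv.Perm.cycleOf_mem_cycleFactorsFinset_iff, Equiv.Perm.mem_support]
    exact (Finset.mem_filter.1 hy).2.ne
  · intro y hy y' hy' h
    have hs : v.1.SameCycle y y' := by
      have h₁ : y' ∈ (v.1.cycleOf y').support := Equiv.Perm.mem_support_cycleOf_iff.2
        ⟨Equiv.Perm.SameCycle.refl _ _,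
          Equiv.Perm.mem_support.2 (Finset.mem_filter.1 hy').2.ne⟩
      rw [← show v.1.cycleOf y = v.1.cycleOf y' from h] at h₁
      exact (Equiv.Perm.mem_support_cycleOf_iff.1 h₁).1
    exact le_antisymm (hv.isMax_of_apply_le hE (Finset.mem_filter.1 hy').2.le hs.symm)
      (hv.isMax_of_apply_le hE (Finset.mem_filter.1 hy).2.le hs)
  · intro σ hσ
    obtain ⟨x, hx, rfl⟩ : ∃ x ∈ v.1.support, σ = v.1.cycleOf x := by
      have hc := (Equiv.Perm.mem_cycleFactorsFinset_iff.1 hσ).1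
      obtain ⟨x, hx, -⟩ := hc
      exact ⟨x, Equiv.Perm.mem_cycleFactorsFinset_support_le hσ (Equiv.Perm.mem_support.2 hx),
        Equiv.Perm.cycle_is_cycleOf (Equiv.Perm.mem_support.2 hx) hσ⟩
    classical
    obtain ⟨y, hy, hmax⟩ := (Finset.univ.filter fun y => v.1.SameCycle x y).exists_max_image id
      ⟨x, by simp [Equiv.Perm.SameCycle.refl]⟩
    rw [Finset.mem_filter] at hy
    have hym : ∀ q, v.1.SameCycle y q → q ≤ y := fun q hq =>
      hmax q (by simpa using hy.2.trans hq)
    refine ⟨y, ?_, hy.2.symm.cycleOf_eq⟩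
    simp only [Finset.mem_filter, Finset.mem_univ, true_and]
    refine lt_of_le_of_ne (hv.le_of_isMax hE hym (Equiv.Perm.SameCycle.refl _ _)) fun h => ?_
    rw [Equiv.Perm.mem_support] at hx
    exact hx ((hy.2.apply_eq_self_iff).2 h)

theorem sameCycle_piT (hn : 2 ≤ n) (w : hyperoctahedral n) (p : SignedPt n) :
    (piT w).1.SameCycle p (w.1 p) := by
  obtain ⟨x, rfl⟩ := ofInt_surjective p
  obtain ⟨y, hy⟩ := ofInt_surjective (w.1 (ofInt x))
  rw [← hy, (rot_piT hn w).sameCycle_iff (isNC_ncClosure w)]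
  exact ncClosure_of_apply hy.symm

/-- Both `p` and `w⁻¹ p` lie in one block of the closure, and popping replaces `w⁻¹ p` by the next
point of that block. This changes whether the value exceeds `p` only if `w⁻¹ p` is the maximum of a
nontrivial block, when it drops to the minimum. Such values are the descents of the projection, one
for each nontrivial cycle. -/
theorem aexc_eq_add_cyc (hn : 2 ≤ n) (w : hyperoctahedral n) :
    aexc w = aexc (pop w) + cyc (piT w) := by
  have hE := isNC_ncClosure w
  have hv := rot_piT hn w
  have hfix : ∀ p, w.1⁻¹ p = p → (piT w).1 p = p := fun p hp =>
    (piT_apply_eq_self_iff hn).2 (by rw [Equiv.Perm.inv_eq_iff_eq] at hp; exact hp.symm)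
  have hs : ∀ p, (piT w).1.SameCycle (w.1⁻¹ p) p := fun p => by
    have := sameCycle_piT hn w (w.1⁻¹ p)
    rwa [show w.1 (w.1⁻¹ p) = p from w.1.apply_symm_apply p] at this
  have h₁ : ∀ p, p < w.1⁻¹ p ↔
      p < (pop w).1⁻¹ p ∨ (piT w).1 (w.1⁻¹ p) < w.1⁻¹ p := by
    intro p
    rw [pop_inv_apply]
    constructor
    · intro h
      rcases le_or_gt (w.1⁻¹ p) ((piT w).1 (w.1⁻¹ p)) with h' | h'
      · exact Or.inl (h.trans_le h')
      · exact Or.inr h'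
    · rintro (h | h)
      · by_contra! hc
        rcases hc.lt_or_eq with hc | hc
        · exact absurd (hv.lt_and_le_of_lt hE (hs p) hc).2 (not_le.2 h)
        · rw [hc, hfix p hc] at h
          exact lt_irrefl _ h
      · refine lt_of_le_of_ne (hv.isMax_of_apply_le hE h.le (hs p)) fun hc => ?_
        rw [← hc, hfix p hc.symm] at h
        exact lt_irrefl _ h
  rw [← hv.card_descents hE]
  unfold aexc
  -- A descent `y = w⁻¹ p` is transported by `w` to the antiexceedance `p` that it destroys.
  rw [← Finset.card_map (s := Finset.univ.filter fun y => (piT w).1 y < y) w.1.toEmbedding, ← Finset.card_union_of_disjoint]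
  · congr 1
    ext p
    simp only [Finset.mem_union, Finset.mem_filter, Finset.mem_univ, true_and, Finset.mem_map,
      Equiv.coe_toEmbedding]
    rw [h₁]
    refine or_congr Iff.rfl ⟨fun h => ⟨_, h, w.1.apply_symm_apply p⟩, ?_⟩
    rintro ⟨q, hq, rfl⟩
    rwa [show w.1⁻¹ (w.1 q) = q from w.1.symm_apply_apply q]
  · rw [Finset.disjoint_left]
    intro p hp hp'
    simp only [Finset.mem_filter, Finset.mem_univ, true_and, Finset.mem_map,
      Equiv.coe_toEmbedding] at hp hp'
    obtain ⟨q, hq, rfl⟩ := hp'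
    have hs' := hs (w.1 q)
    rw [pop_inv_apply] at hp
    rw [show w.1⁻¹ (w.1 q) = q from w.1.symm_apply_apply q] at hp hs'
    exact absurd (hv.le_of_isMax hE (fun _ => hv.isMax_of_apply_le hE hq.le) hs') (not_le.2 hp)

theorem piT_eq_one_iff (hn : 2 ≤ n) {w : hyperoctahedral n} : piT w = 1 ↔ w = 1 := by
  constructor
  · intro h
    apply Subtype.ext
    ext p : 1
    exact (piT_apply_eq_self_iff hn).1 (by rw [h]; rfl)
  · rintro rfl
    apply Subtype.ext
    ext p : 1
    exact (piT_apply_eq_self_iff hn).2 rfl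

theorem pop_one (hn : 2 ≤ n) : pop (1 : hyperoctahedral n) = 1 := by
  change 1 * (piT (1 : hyperoctahedral n))⁻¹ = 1
  rw [(piT_eq_one_iff hn).2 rfl, inv_one, one_mul]

theorem cyc_piT_pos (hn : 2 ≤ n) {w : hyperoctahedral n} (hw : w ≠ 1) : 0 < cyc (piT w) := by
  rw [Nat.pos_iff_ne_zero]
  intro h
  rw [cyc, Finset.card_eq_zero, Equiv.Perm.cycleFactorsFinset_eq_empty_iff] at h
  exact hw ((piT_eq_one_iff hn).1 (Subtype.ext h))

theorem aexc_pop_lt (hn : 2 ≤ n) {w : hyperoctahedral n} (hw : w ≠ 1) :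
    aexc (pop w) < aexc w := by
  have h₁ := aexc_eq_add_cyc hn w
  have h₂ := cyc_piT_pos hn hw
  omega

theorem ncard_forwardOrbit_one (hn : 2 ≤ n) :
    (forwardOrbit pop (1 : hyperoctahedral n)).ncard = 1 := by
  have h : ∀ k, pop^[k] (1 : hyperoctahedral n) = 1 := fun k =>
    Function.iterate_fixed (pop_one hn) k
  have : forwardOrbit pop (1 : hyperoctahedral n) = {1} := by
    ext y
    simp only [forwardOrbit, h, Set.range_const]
  rw [this, Set.ncard_singleton]

/-- The number of antiexceedances drops strictly at the first step and never increases again, so `w`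
does not recur. -/
theorem ncard_forwardOrbit_pop (hn : 2 ≤ n) {w : hyperoctahedral n} (hw : w ≠ 1) :
    (forwardOrbit pop w).ncard = (forwardOrbit pop (pop w)).ncard + 1 := by
  rw [forwardOrbit_eq_insert, Set.ncard_insert_of_notMem]
  rintro ⟨k, hk⟩
  have hle : ∀ k, aexc (pop^[k] (pop w)) ≤ aexc (pop w) := by
    intro k
    induction k with
    | zero => exact le_rfl
    | succ k ih =>
      rw [Function.iterate_succ_apply']
      have := aexc_eq_add_cyc hn (pop^[k] (pop w))
      omega
  have h₁ := hle k
  have h₂ := aexc_pop_lt hn hw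
  have h₃ : aexc (pop^[k] (pop w)) = aexc w := congrArg aexc hk
  omega

theorem ncard_forwardOrbit_le (hn : 2 ≤ n) (w : hyperoctahedral n) :
    (forwardOrbit pop w).ncard ≤ aexc w + 1 := by
  induction hm : aexc w using Nat.strong_induction_on generalizing w with
  | _ m ih =>
    by_cases hw : w = 1
    · rw [hw, ncard_forwardOrbit_one hn]
      omega
    · have h₁ := aexc_pop_lt hn hw
      have h₂ := ih _ (by omega) (pop w) rfl
      rw [ncard_forwardOrbit_pop hn hw]
      omega

end Hyperoctahedral

/-! ### The shuffle invariant and persistence of a single nontrivial block -/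

namespace Hyperoctahedral

open SignedPt

variable {n : ℕ}

/-- The interval `[a, b]` contains exactly one representative of each point of the block of `a`. -/
def IsSpan (n : ℕ) (E : ℤ → ℤ → Prop) (a b : ℤ) : Prop :=
  a < b ∧ b < a + 2 * n ∧ E a b ∧ ∀ y, b < y → y < a + 2 * n → ¬ E a y

theorem exists_isSpan {E : ℤ → ℤ → Prop} {x y : ℤ} (hxy : x < y) (hy : y < x + 2 * n)
    (h : E x y) : ∃ b, IsSpan n E x b := by
  classical
  obtain ⟨b, ⟨h₁, h₂, h₃⟩, h₄⟩ := Int.exists_greatest_of_bdd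
    (P := fun b => x < b ∧ b < x + 2 * n ∧ E x b) ⟨x + 2 * n, fun z hz => hz.2.1.le⟩
    ⟨y, hxy, hy, h⟩
  refine ⟨b, h₁, h₂, h₃, fun z hz hz' hc => ?_⟩
  have := h₄ z ⟨by omega, hz', hc⟩
  omega

theorem cyc_eq_one_iff {v : hyperoctahedral n} : cyc v = 1 ↔ v.1.IsCycle := by
  rw [cyc, Finset.card_eq_one]
  constructor
  · rintro ⟨σ, hσ⟩
    exact (Equiv.Perm.cycleFactorsFinset_eq_singleton_iff.1 hσ).1
  · exact fun h => ⟨_, h.cycleFactorsFinset_eq_singleton⟩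

variable [NeZero n]

/-- `f` lifts `w⁻¹` to the integers, with `x < f x ≤ x + 2n`. -/
def IsLift (w : hyperoctahedral n) (f : ℤ → ℤ) : Prop :=
  ∀ x, x < f x ∧ f x ≤ x + 2 * n ∧ (ofInt (f x) : SignedPt n) = w.1⁻¹ (ofInt x)

theorem exists_isLift (w : hyperoctahedral n) : ∃ f, IsLift w f := by
  have h : ∀ x : ℤ, ∃ z, x < z ∧ z ≤ x + 2 * n ∧ (ofInt z : SignedPt n) = w.1⁻¹ (ofInt x) := by
    intro x
    obtain ⟨z, h₁, h₂, h₃⟩ := exists_ofInt_window (n := n) (x + 1) (w.1⁻¹ (ofInt x))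
    exact ⟨z, by omega, by omega, h₃⟩
  choose f hf using h
  exact ⟨f, hf⟩

namespace IsLift

variable {w : hyperoctahedral n} {f : ℤ → ℤ}

theorem eq_of_ofInt (hf : IsLift w f) {x z : ℤ} (h₁ : x < z) (h₂ : z ≤ x + 2 * n)
    (h₃ : (ofInt z : SignedPt n) = w.1⁻¹ (ofInt x)) : f x = z := by
  obtain ⟨h₄, h₅, h₆⟩ := hf x
  exact eq_of_ofInt_eq (h₆.trans h₃.symm) (by omega) (by omega)

theorem add_self (hf : IsLift w f) (x : ℤ) : f (x + n) = f x + n := by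
  obtain ⟨h₁, h₂, h₃⟩ := hf x
  refine hf.eq_of_ofInt (by omega) (by omega) ?_
  rw [ofInt_add_self, h₃, ofInt_add_self]
  exact ((w⁻¹).2 _).symm

theorem injective (hf : IsLift w f) : Function.Injective f := by
  intro x y h
  obtain ⟨h₁, h₂, h₃⟩ := hf x
  obtain ⟨h₄, h₅, h₆⟩ := hf y
  rw [h, h₆] at h₃
  exact eq_of_ofInt_eq (w.1⁻¹.injective h₃).symm (by omega) (by omega)

theorem eq_add_iff (hf : IsLift w f) {x : ℤ} : f x = x + 2 * n ↔ w.1 (ofInt x) = ofInt x := by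
  have hn := two_mul_pos n
  constructor
  · intro h
    have h₁ := (hf x).2.2
    rw [h, ofInt_add_two_mul, eq_comm, Equiv.Perm.inv_eq_iff_eq] at h₁
    exact h₁.symm
  · intro h
    refine hf.eq_of_ofInt (by omega) le_rfl ?_
    rw [ofInt_add_two_mul, eq_comm, Equiv.Perm.inv_eq_iff_eq]
    exact h.symm

theorem rel (hf : IsLift w f) (x : ℤ) : ncClosure w x (f x) := by
  refine (isNC_ncClosure w).symm (ncClosure_of_apply ?_)
  rw [(hf x).2.2]
  exact w.1.apply_symm_apply _

theorem ne_add_of_rel (hf : IsLift w f) {x y : ℤ} (hxy : x < y) (hy : y < x + 2 * n)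
    (h : ncClosure w x y) : f x ≠ x + 2 * n := by
  intro hx
  have := eq_of_ofInt_eq (ofInt_eq_of_ncClosure (hf.eq_add_iff.1 hx) h) (by omega) (by omega)
  omega

theorem ne_add_shift (hf : IsLift w f) {x : ℤ} (h : f x ≠ x + 2 * n) :
    f (x + n) ≠ x + n + 2 * n := by
  rw [hf.add_self]
  omega

end IsLift

/-- Invariant of the orbits with one nontrivial block in every step: the order of the values of the
lift on the points that are not fixed is governed by a set `S` of integers. -/
structure IsShuffle (w : hyperoctahedral n) (f : ℤ → ℤ) (S : ℤ → Prop) : Prop where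
  lift : IsLift w f
  period : ∀ x, S (x + n) ↔ S x
  inversion : ∀ x y, x < y → f x ≠ x + 2 * n → f y ≠ y + 2 * n → f y < f x →
    S x ∧ ¬ S y ∧ ∀ z, x < z → z < y → ¬ S z
  separated : ∀ b, S b → f b ≠ b + 2 * n →
    ∃ p, b - n < p ∧ p < b ∧ f p ≠ p + 2 * n ∧ ∃ z, b - n < z ∧ z ≤ p ∧ S z

/-- If there are two nontrivial blocks, then some nontrivial block is an interval of the points that
are not fixed, and it is disjoint from its opposite. -/
theorem exists_interval_block {w : hyperoctahedral n} {f : ℤ → ℤ} (hf : IsLift w f) {x y : ℤ}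
    (hx : f x ≠ x + 2 * n) (hy : f y ≠ y + 2 * n) (hxy : ¬ ncClosure w x y) :
    ∃ a b, IsSpan n (ncClosure w) a b ∧ b < a + n ∧
      ∀ p, a < p → p < b → f p ≠ p + 2 * n → ncClosure w a p := by
  classical
  have hE := isNC_ncClosure w
  -- The block is chosen with a span of least length.
  have hex : ∃ m : ℕ, ∃ a b : ℤ, IsSpan n (ncClosure w) a b ∧ b - a = m := by
    obtain ⟨h₁, h₂, -⟩ := hf x
    obtain ⟨b, hb⟩ := exists_isSpan (n := n) h₁ (lt_of_le_of_ne h₂ hx) (hf.rel x)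
    exact ⟨(b - x).toNat, x, b, hb, by have := hb.1; omega⟩
  obtain ⟨a, b, hab, hm⟩ := Nat.find_spec hex
  have hmin : ∀ a' b', IsSpan n (ncClosure w) a' b' → b - a ≤ b' - a' := by
    intro a' b' h
    have h₁ := Nat.find_min' hex ⟨a', b', h, (Int.toNat_of_nonneg (by linarith [h.1])).symm⟩
    have h₂ := h.1
    omega
  clear hm
  obtain ⟨hab₁, hab₂, hab₃, hab₄⟩ := hab
  have hA : ∀ p, a < p → p < b → f p ≠ p + 2 * n → ncClosure w a p := by
    intro p hp hp' hfp
    by_contra hc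
    -- Noncrossing traps a foreign block that meets `(a, b)` inside it, and that block would have a
    -- shorter span.
    have hin : ∀ q, a < q → q < a + 2 * n → ncClosure w p q → q < b := by
      intro q hq hq' hpq
      by_contra! hbq
      rcases hbq.lt_or_eq with hbq | rfl
      · exact hc (hE.noncross hp hp' hbq hq' hab₃ hpq)
      · exact hc (hE.trans hab₃ (hE.symm hpq))
    obtain ⟨q, hq, hq', hpq, hne⟩ :
        ∃ q, a < q ∧ q < a + 2 * n ∧ ncClosure w p q ∧ q ≠ p := by
      obtain ⟨h₁, h₂, -⟩ := hf p
      have h₃ := hf.rel p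
      by_cases h : f p < a + 2 * n
      · exact ⟨f p, by omega, h, h₃, by omega⟩
      · have h₄ : f p ≠ a + 2 * n := fun h₄ =>
          hc (hE.trans (hE.period a) (hE.symm (h₄ ▸ h₃)))
        have h₅ := hE.period (f p - 2 * n)
        rw [sub_add_cancel] at h₅
        exact ⟨f p - 2 * n, by omega, by omega, hE.trans h₃ (hE.symm h₅), by omega⟩
    obtain ⟨a', ⟨ha₁, ha₂, ha₃⟩, ha₄⟩ := Int.exists_least_of_bdd
      (P := fun q => a < q ∧ q < a + 2 * n ∧ ncClosure w p q) ⟨a, fun q hq => hq.1.le⟩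
      ⟨p, hp, by omega, hE.rfl' p⟩
    have h₁ := ha₄ p ⟨hp, by omega, hE.rfl' p⟩
    have h₂ := ha₄ q ⟨hq, hq', hpq⟩
    obtain ⟨b', hb⟩ := exists_isSpan (n := n) (E := ncClosure w) (x := a') (y := max p q)
      (by omega) (by omega) (by
        rcases max_choice p q with h | h <;> rw [h]
        · exact hE.symm ha₃
        · exact hE.trans (hE.symm ha₃) hpq)
    have h₃ : b' < a + 2 * n := by
      by_contra! h₃
      have h₄ := hb.2.1
      have h₅ : b' ≠ a + 2 * n := by
        rintro rfl
        exact hc (hE.trans (hE.period a) (hE.symm (hE.trans ha₃ hb.2.2.1)))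
      have h₆ := hE.period (b' - 2 * n)
      rw [sub_add_cancel] at h₆
      have := ha₄ (b' - 2 * n) ⟨by omega, by omega,
        hE.trans ha₃ (hE.trans hb.2.2.1 (hE.symm h₆))⟩
      omega
    have h₄ := hin b' (by have := hb.1; omega) h₃ (hE.trans ha₃ hb.2.2.1)
    have h₅ := hmin a' b' hb
    omega
  refine ⟨a, b, ⟨hab₁, hab₂, hab₃, hab₄⟩, ?_, hA⟩
  -- If the shortest span covers a half turn, then `a` is related to `a + n`, and by symmetry all
  -- points that are not fixed form one block.
  by_contra! hba
  have hn := two_mul_pos n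
  have hfa : f a ≠ a + 2 * n := hf.ne_add_of_rel hab₁ hab₂ hab₃
  have haa : ncClosure w a (a + n) := by
    rcases hba.lt_or_eq with h | h
    · exact hA _ (by omega) h (hf.ne_add_shift hfa)
    · rw [h]
      exact hab₃
  have key : ∀ q, f q ≠ q + 2 * n → ncClosure w a q := by
    intro q hq
    obtain ⟨q', k, h₁, h₂, rfl⟩ := exists_window_half (n := n) a q
    have hq' : f q' ≠ q' + 2 * n ∧ ∀ k : ℤ, (ncClosure w a q' → ncClosure w a (q' + n * k)) := by
      constructor
      · have hk : ∀ k : ℤ, f (q' + n * k) = f q' + n * k := by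
          intro k
          induction k using Int.induction_on with
          | zero => simp
          | succ k ih => rw [mul_add, mul_one, ← add_assoc, hf.add_self, ih]; ring
          | pred k ih =>
            have := hf.add_self (q' + n * (-k - 1))
            rw [show q' + n * (-k - 1) + n = q' + n * (-(k : ℤ)) by ring, ih] at this
            linarith
        rw [hk] at hq
        intro h
        apply hq
        rw [h]
        ring
      · intro k h
        induction k using Int.induction_on with
        | zero => simpa using h
        | succ k ih =>
          rw [mul_add, mul_one, ← add_assoc]
          exact hE.trans haa (hE.shift ih)
        | pred k ih =>
          rw [← hE.shift_iff, mul_sub, mul_one, ← add_sub_assoc, sub_add_cancel]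
          exact hE.trans (hE.symm haa) ih
    refine hq'.2 k ?_
    rcases h₂.lt_or_eq with h₂ | rfl
    · exact hA q' h₁ (by omega) hq'.1
    · exact haa
  exact hxy (hE.trans (hE.symm (key x hx)) (key y hy))

/-- An interval block `[a, b]` forces `f` to map `a` inside the block and `b` past the end of the
turn, so `b` is inverted with `a + n`. The inversion condition then leaves no room for the points
`p` and `z` that `separated` provides for `b`. -/
theorem IsShuffle.rel {w : hyperoctahedral n} {f : ℤ → ℤ} {S : ℤ → Prop} (h : IsShuffle w f S)
    {x y : ℤ} (hx : f x ≠ x + 2 * n) (hy : f y ≠ y + 2 * n) : ncClosure w x y := by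
  by_contra hxy
  have hE := isNC_ncClosure w
  have hf := h.lift
  obtain ⟨a, b, ⟨hab₁, hab₂, hab₃, hab₄⟩, hba, hA⟩ := exists_interval_block hf hx hy hxy
  have hfa : f a ≠ a + 2 * n := hf.ne_add_of_rel hab₁ hab₂ hab₃
  have hfb : f b ≠ b + 2 * n :=
    hf.ne_add_of_rel hab₂ (by omega) (hE.trans (hE.symm hab₃) (hE.period a))
  have ha : f a ≤ b := by
    by_contra! hc
    have := (hf a).2.1
    exact hab₄ _ hc (by omega) (hf.rel a)
  have hb : a + 2 * n ≤ f b := by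
    by_contra! hc
    exact hab₄ _ (hf b).1 hc (hE.trans hab₃ (hf.rel b))
  have ha' := hf.add_self a
  -- Such a `p` overtakes `a + n`, because `f (a + n) = f a + n ≤ b + n < a + 2n`.
  have hwrap : ∀ p, p < a + n → f p ≠ p + 2 * n → a + 2 * n ≤ f p →
      S p ∧ ¬ S (a + n) ∧ ∀ z, p < z → z < a + n → ¬ S z := fun p hp hfp hp' =>
    h.inversion p (a + n) hp hfp (hf.ne_add_shift hfa) (by omega)
  obtain ⟨hSb, -, hSb'⟩ := hwrap b hba hfb hb
  obtain ⟨p, hp₁, hp₂, hp₃, z, hz₁, hz₂, hz₃⟩ := h.separated b hSb hfb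
  by_cases hpa : p < a
  · exact hSb' (z + n) (by omega) (by omega) ((h.period z).2 hz₃)
  have hap : ncClosure w a p := by
    rcases (not_lt.1 hpa).lt_or_eq with h' | rfl
    · exact hA p h' hp₂ hp₃
    · exact hE.rfl' _
  have hfp : f p ≤ b := by
    by_contra! hc
    by_cases hc' : f p < a + 2 * n
    · exact hab₄ _ hc hc' (hE.trans hap (hf.rel p))
    · exact (hwrap p (by omega) hp₃ (by omega)).2.2 b hp₂ hba hSb
  have hbn := hf.add_self (b - n)
  rw [sub_add_cancel] at hbn
  -- Now `b - n` overtakes `p`, since `f p ≤ b < a + n ≤ f (b - n)`, although `(b - n, p]` contains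
  -- `z ∈ S`.
  obtain ⟨-, h₁, h₂⟩ := h.inversion (b - n) p hp₁ (by omega) hp₃ (by omega)
  rcases hz₂.lt_or_eq with hz₂ | rfl
  · exact h₂ z hz₁ hz₂ hz₃
  · exact h₁ hz₃

theorem cyc_eq_one_of_rel (hn : 2 ≤ n) {w : hyperoctahedral n} (hw : w ≠ 1)
    (h : ∀ x y, w.1 (ofInt x) ≠ ofInt x → w.1 (ofInt y) ≠ ofInt y → ncClosure w x y) :
    cyc (piT w) = 1 := by
  rw [cyc_eq_one_iff]
  obtain ⟨p, hp⟩ : ∃ p, w.1 p ≠ p := by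
    by_contra! hc
    exact hw (Subtype.ext (Equiv.ext hc))
  refine ⟨p, mt (piT_apply_eq_self_iff hn).1 hp, fun q hq => ?_⟩
  obtain ⟨x, rfl⟩ := ofInt_surjective p
  obtain ⟨y, rfl⟩ := ofInt_surjective q
  exact ((rot_piT hn w).sameCycle_iff (isNC_ncClosure w)).2
    (h x y hp (mt (piT_apply_eq_self_iff hn).2 hq))

theorem rel_of_cyc_eq_one (hn : 2 ≤ n) {w : hyperoctahedral n} (h : cyc (piT w) = 1) {x y : ℤ}
    (hx : w.1 (ofInt x) ≠ ofInt x) (hy : w.1 (ofInt y) ≠ ofInt y) : ncClosure w x y :=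
  ((rot_piT hn w).sameCycle_iff (isNC_ncClosure w)).1 <| (cyc_eq_one_iff.1 h).sameCycle
    (mt (piT_apply_eq_self_iff hn).1 hx) (mt (piT_apply_eq_self_iff hn).1 hy)

/-- The invariant is preserved by `Pop_T`. -/
theorem IsShuffle.pop (hn : 2 ≤ n) {w : hyperoctahedral n} {f : ℤ → ℤ} {S : ℤ → Prop}
    (h : IsShuffle w f S) : ∃ f', IsShuffle (pop w) f' S := by
  classical
  have hE := isNC_ncClosure w
  have hv := rot_piT hn w
  have hf := h.lift
  choose g hg hg' using hE.exists_isNext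
  -- Popping advances each value to its successor in the block; a fixed point, lifted to `x + 2n`,
  -- must not advance any further.
  let f' : ℤ → ℤ := fun x => if f x = x + 2 * n then x + 2 * n else g (f x)
  have hfix : ∀ x, f x = x + 2 * n → f' x = x + 2 * n := fun x hx => if_pos hx
  have hmov : ∀ x, f x ≠ x + 2 * n → f' x = g (f x) := fun x hx => if_neg hx
  have hR : ∀ x, f' x ≠ x + 2 * n → f x ≠ x + 2 * n := fun x hx hc => hx (hfix x hc)
  have hlift : IsLift (Hyperoctahedral.pop w) f' := by
    intro x
    obtain ⟨h₁, h₂, h₃⟩ := hf x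
    rw [pop_inv_apply, ← h₃]
    by_cases hx : f x = x + 2 * n
    · rw [hfix x hx, hx, ofInt_add_two_mul]
      refine ⟨by omega, le_rfl, ?_⟩
      rw [(piT_apply_eq_self_iff hn).2 (hf.eq_add_iff.1 hx)]
    · rw [hmov x hx, hv _ _ (hg (f x))]
      exact ⟨h₁.trans (hg (f x)).1, (hg (f x)).le (by omega)
        (hE.trans (hE.symm (hf.rel x)) (hE.period x)), rfl⟩
  -- All points that are not fixed share one block, on which the successor is increasing; so no new
  -- inversion appears.
  have hmono : ∀ x y, f x ≠ x + 2 * n → f y ≠ y + 2 * n → f x < f y → f' x < f' y := by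
    intro x y hx hy hxy
    rw [hmov x hx, hmov y hy]
    exact ((hg (f x)).le hxy (hE.trans (hE.symm (hf.rel x))
      (hE.trans (h.rel hx hy) (hf.rel y)))).trans_lt (hg (f y)).1
  have hinv : ∀ x y, x < y → f x ≠ x + 2 * n → f y ≠ y + 2 * n → f' y < f' x →
      S x ∧ ¬ S y ∧ ∀ z, x < z → z < y → ¬ S z := by
    intro x y hxy hx hy hlt
    refine h.inversion x y hxy hx hy ?_
    rcases lt_trichotomy (f x) (f y) with h₁ | h₁ | h₁
    · exact absurd (hmono x y hx hy h₁) (by omega)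
    · exact absurd (hf.injective h₁) hxy.ne
    · exact h₁
  refine ⟨f', hlift, h.period, fun x y hxy hx hy => hinv x y hxy (hR x hx) (hR y hy), ?_⟩
  intro b hSb hb
  obtain ⟨p, hp₁, hp₂, hp₃, z, hz₁, hz₂, hz₃⟩ := h.separated b hSb (hR b hb)
  by_cases hp : f' p = p + 2 * n
  swap
  · exact ⟨p, hp₁, hp₂, hp, z, hz₁, hz₂, hz₃⟩
  -- If the witness `p` has become fixed, the next point `q` that is not fixed replaces it. It must
  -- be shown that `q ≠ b`, which follows from an inversion of `p` and `q`.
  obtain ⟨q, ⟨hq₁, hq₂⟩, hq₃⟩ := Int.exists_least_of_bdd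
    (P := fun q => p < q ∧ f' q ≠ q + 2 * n) ⟨p, fun q hq => hq.1.le⟩ ⟨b, hp₂, hb⟩
  have hqb := hq₃ b ⟨hp₂, hb⟩
  obtain ⟨h₁, h₂, h₃⟩ := hlift q
  -- Otherwise `f' q - 2n` lies in `[p, q)` and is not fixed, although `p` is fixed and `q` is the
  -- first point after it that is not.
  have hlt : f' q < f' p := by
    rw [hp]
    by_contra! hc
    have h₄ : f' (f' q - 2 * n) ≠ f' q - 2 * n + 2 * n := by
      intro h₄
      have h₅ := (hlift (f' q - 2 * n)).2.2
      rw [← ofInt_add_two_mul (f' q - 2 * n), sub_add_cancel] at h₅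
      rw [h₄, sub_add_cancel] at h₅
      have h₆ : (ofInt (f' q) : SignedPt n) = ofInt q :=
        (Hyperoctahedral.pop w).1⁻¹.injective (by rw [← h₃, ← h₅])
      rw [← ofInt_add_two_mul q] at h₆
      exact hq₂ (eq_of_ofInt_eq h₆ (by omega) (by omega))
    rcases hc.lt_or_eq with hc | hc
    · have := hq₃ (f' q - 2 * n) ⟨by omega, h₄⟩
      omega
    · rw [← hc, add_sub_cancel_right] at h₄
      exact h₄ hp
  obtain ⟨-, hSq, -⟩ := hinv p q hq₁ hp₃ (hR q hq₂) hlt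
  have hne : q ≠ b := fun hc => hSq (hc ▸ hSb)
  exact ⟨q, by omega, by omega, hq₂, z, hz₁, by omega, hz₃⟩

theorem IsShuffle.cyc_eq_one (hn : 2 ≤ n) {w : hyperoctahedral n} {f : ℤ → ℤ} {S : ℤ → Prop}
    (h : IsShuffle w f S) (hw : w ≠ 1) : cyc (piT w) = 1 :=
  cyc_eq_one_of_rel hn hw fun _ _ hx hy =>
    h.rel (mt h.lift.eq_add_iff.1 hx) (mt h.lift.eq_add_iff.1 hy)

theorem IsShuffle.ncard_forwardOrbit (hn : 2 ≤ n) {w : hyperoctahedral n} {f : ℤ → ℤ}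
    {S : ℤ → Prop} (h : IsShuffle w f S) :
    (forwardOrbit Hyperoctahedral.pop w).ncard = aexc w + 1 := by
  induction hm : aexc w using Nat.strong_induction_on generalizing w f with
  | _ m ih =>
    by_cases hw : w = 1
    · subst hw
      rw [ncard_forwardOrbit_one hn, ← hm]
      simp [aexc]
    · have h₁ := aexc_eq_add_cyc hn w
      rw [h.cyc_eq_one hn hw] at h₁
      obtain ⟨f', h'⟩ := h.pop hn
      have h₂ := ih _ (by omega) h' rfl
      rw [ncard_forwardOrbit_pop hn hw, h₂]
      omega

end Hyperoctahedral

/-! ### Juggling patterns with at most two balls -/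

namespace Hyperoctahedral

open SignedPt

variable {n : ℕ}

/-- `f` throws each `x ∉ S` to `x + 1`, and each `x ∈ S` to `s + 1` where `s` is the next element
of `S`. -/
structure IsThrow (n : ℕ) (f : ℤ → ℤ) (S : ℤ → Prop) : Prop where
  period : ∀ x, S (x + n) ↔ S x
  of_not : ∀ x, ¬ S x → f x = x + 1
  of_next : ∀ x s, S x → IsNext (fun _ z => S z) x s → f x = s + 1

theorem period_mul {S : ℤ → Prop} (hS : ∀ x, S (x + n) ↔ S x) (x k : ℤ) :
    S (x + n * k) ↔ S x := by
  induction k using Int.induction_on with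
  | zero => simp
  | succ k ih => rw [mul_add, mul_one, ← add_assoc, hS, ih]
  | pred k ih =>
    rw [← hS, show x + n * (-k - 1) + n = x + n * (-(k : ℤ)) by ring, ih]

theorem exists_isNext_of_nonempty [NeZero n] {S : ℤ → Prop} (hS : ∀ x, S (x + n) ↔ S x)
    (hne : ∃ s, S s) (x : ℤ) : ∃ s, IsNext (fun _ z => S z) x s ∧ s ≤ x + n := by
  obtain ⟨s, hs⟩ := hne
  obtain ⟨y, k, h₁, h₂, rfl⟩ := exists_window_half (n := n) x s
  obtain ⟨z, hz, hzy⟩ := exists_isNext_of_lt (E := fun _ z => S z) h₁ ((period_mul hS y k).1 hs)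
  exact ⟨z, hz, hzy.trans h₂⟩

/-- The integers below `m` that `f` sends to `m` or beyond. -/
noncomputable def crossing (n : ℕ) (f : ℤ → ℤ) (m : ℤ) : Finset ℤ :=
  (Finset.Ico (m - 2 * n) m).filter fun x => m ≤ f x

theorem mem_crossing {f : ℤ → ℤ} {m x : ℤ} :
    x ∈ crossing n f m ↔ (m - 2 * n ≤ x ∧ x < m) ∧ m ≤ f x := by
  simp [crossing]

variable [NeZero n] {w : hyperoctahedral n} {f : ℤ → ℤ} {S : ℤ → Prop}

theorem IsLift.exists_eq (hf : IsLift w f) (m : ℤ) : ∃ y, f y = m ∧ m - 2 * n ≤ y ∧ y < m := by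
  obtain ⟨y, h₁, h₂, h₃⟩ := exists_ofInt_window (n := n) (m - 2 * n) (w.1 (ofInt m))
  refine ⟨y, hf.eq_of_ofInt (by omega) (by omega) ?_, h₁, by omega⟩
  rw [h₃]
  exact (w.1.symm_apply_apply _).symm

theorem IsLift.mem_crossing (hf : IsLift w f) {m x : ℤ} (h₁ : x < m) (h₂ : m ≤ f x) :
    x ∈ crossing n f m := by
  have := (hf x).2.1
  exact Hyperoctahedral.mem_crossing.2 ⟨⟨by omega, h₁⟩, h₂⟩

/-- The set counts balls in the air: at time `m` exactly one ball lands, and it is thrown again from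
`m`. -/
theorem IsLift.card_crossing_add_one (hf : IsLift w f) (m : ℤ) :
    (crossing n f (m + 1)).card = (crossing n f m).card := by
  obtain ⟨y, hy, hy₁, hy₂⟩ := hf.exists_eq m
  have hmem : y ∈ crossing n f m := hf.mem_crossing hy₂ hy.ge
  have h : crossing n f (m + 1) = insert m ((crossing n f m).erase y) := by
    ext x
    rw [Finset.mem_insert, Finset.mem_erase, Hyperoctahedral.mem_crossing,
      Hyperoctahedral.mem_crossing]
    have hx := hf x
    have hinj : f x = m → x = y := fun h => hf.injective (h.trans hy.symm)
    constructor
    · rintro ⟨⟨h₁, h₂⟩, h₃⟩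
      by_cases hxm : x = m
      · exact Or.inl hxm
      · refine Or.inr ⟨?_, ⟨by omega, by omega⟩, by omega⟩
        rintro rfl
        omega
    · rintro (rfl | ⟨h₁, ⟨h₂, h₃⟩, h₄⟩)
      · have := two_mul_pos n
        exact ⟨⟨by omega, by omega⟩, by omega⟩
      · have h₅ : f x ≠ m := fun h => h₁ (hinj h)
        exact ⟨⟨by omega, by omega⟩, by omega⟩
  rw [h, Finset.card_insert_of_notMem, Finset.card_erase_of_mem hmem]
  · have := Finset.card_pos.2 ⟨y, hmem⟩
    omega
  · simp [Hyperoctahedral.mem_crossing]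

theorem IsLift.card_crossing_eq (hf : IsLift w f) (m : ℤ) :
    (crossing n f m).card = (crossing n f 0).card := by
  induction m using Int.induction_on with
  | zero => rfl
  | succ k ih => rw [hf.card_crossing_add_one, ih]
  | pred k ih => rw [← ih, ← hf.card_crossing_add_one, sub_add_cancel]

/-- On `[0, 2n)` the antiexceedances are the points whose throw lands before `2n`; the others, fixed
points included, cross `2n`. -/
theorem IsLift.aexc_add_card_crossing (hf : IsLift w f) (m : ℤ) :
    aexc w + (crossing n f m).card = 2 * n := by
  have h₁ : aexc w = ((Finset.Ico (0 : ℤ) (2 * n)).filter fun x => ¬ 2 * n ≤ f x).card := by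
    symm
    refine Finset.card_bij (fun x _ => ofInt x) ?_ ?_ ?_
    · intro x hx
      simp only [Finset.mem_filter, Finset.mem_Ico, Finset.mem_univ, true_and] at hx ⊢
      have := hf x
      rw [← (hf x).2.2, ofInt_lt_iff (by omega) (by omega) (by omega) (by omega)]
      omega
    · intro x hx y hy h
      simp only [Finset.mem_filter, Finset.mem_Ico] at hx hy
      exact eq_of_ofInt_eq h (by omega) (by omega)
    · intro p hp
      obtain ⟨x, hx, hx', rfl⟩ := exists_ofInt_window (n := n) 0 p
      simp only [Finset.mem_filter, Finset.mem_univ, true_and] at hp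
      refine ⟨x, ?_, rfl⟩
      simp only [Finset.mem_filter, Finset.mem_Ico]
      refine ⟨⟨hx, by omega⟩, fun hc => ?_⟩
      have := hf x
      rw [← (hf x).2.2, ← sub_add_cancel (f x) (2 * n), ofInt_add_two_mul,
        ofInt_lt_iff (by omega) (by omega) (by omega) (by omega)] at hp
      omega
  have h₂ := Finset.card_filter_add_card_filter_not (s := Finset.Ico (0 : ℤ) (2 * n))
    (fun x => 2 * n ≤ f x)
  rw [hf.card_crossing_eq m, ← hf.card_crossing_eq (2 * n), h₁, crossing, sub_self]
  simp only [Int.card_Ico, sub_zero] at h₂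
  omega

theorem IsLift.self_mem_crossing (hf : IsLift w f) (x : ℤ) : x ∈ crossing n f (x + 1) :=
  hf.mem_crossing (by omega) (by have := (hf x).1; omega)

theorem aexc_lt (w : hyperoctahedral n) : aexc w < 2 * n := by
  obtain ⟨f, hf⟩ := exists_isLift w
  have h₁ := hf.aexc_add_card_crossing 1
  have h₂ := Finset.card_pos.2 ⟨_, hf.self_mem_crossing 0⟩
  rw [zero_add] at h₂
  omega

/-- With at most two balls, a ball thrown past `x + 1` stays up while the other goes from each point
to the next. It comes down only when that other ball is thrown past its next point, just after the
next element of `S`. -/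
theorem IsLift.isThrow_of_aexc (hf : IsLift w f) (h : 2 * n ≤ aexc w + 2) :
    IsThrow n f fun x => f x ≠ x + 1 where
  period x := by
    rw [hf.add_self]
    omega
  of_not x hx := not_not.1 hx
  of_next x s hx hs := by
    obtain ⟨hs₁, hs₂, hs₃⟩ := hs
    obtain ⟨z, hz, -, hz'⟩ := hf.exists_eq (s + 1)
    obtain ⟨y, hy, -, hy'⟩ := hf.exists_eq (x + 1)
    have hzs : z ≠ s := fun hc => hs₂ (by rw [← hc, hz, hc])
    have hzx : z ≤ x := by
      by_contra! hc
      have := hs₃ z hc (by omega)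
      omega
    by_contra hne
    have h₁ : z ≠ x := fun hc => hne (by rw [← hc, hz])
    have h₂ : y ≠ x := fun hc => hx (by rw [← hc, hy, hc])
    have h₃ : y ≠ z := fun hc => by rw [hc, hz] at hy; omega
    -- If the ball from `x` did not land at `s + 1`, it, the ball landing at `x + 1` and the one
    -- landing at `s + 1` would be three balls in the air at once.
    have h₄ : ({x, y, z} : Finset ℤ) ⊆ crossing n f (x + 1) := by
      intro t ht
      simp only [Finset.mem_insert, Finset.mem_singleton] at ht
      rcases ht with rfl | rfl | rfl
      · exact hf.self_mem_crossing _
      · exact hf.mem_crossing hy' hy.ge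
      · exact hf.mem_crossing (by omega) (by omega)
    have h₅ := Finset.card_le_card h₄
    rw [Finset.card_eq_three.2 ⟨x, y, z, h₂.symm, h₁.symm, h₃, rfl⟩] at h₅
    have h₆ := hf.aexc_add_card_crossing (x + 1)
    omega

theorem IsLift.exists_ne_of_aexc (hf : IsLift w f) (h : aexc w + 2 = 2 * n) :
    ∃ s, f s ≠ s + 1 := by
  by_contra! hc
  have h₁ : crossing n f 1 = {0} := by
    ext x
    rw [Hyperoctahedral.mem_crossing, Finset.mem_singleton, hc]
    have := two_mul_pos n
    omega
  have h₂ := hf.aexc_add_card_crossing 1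
  rw [h₁, Finset.card_singleton] at h₂
  omega

theorem IsLift.eq_add_one_of_aexc (hf : IsLift w f) (h : aexc w + 1 = 2 * n) (x : ℤ) :
    f x = x + 1 := by
  obtain ⟨y, hy, -, hy'⟩ := hf.exists_eq (x + 1)
  have h₁ := hf.aexc_add_card_crossing (x + 1)
  have h₂ : (crossing n f (x + 1)).card ≤ 1 := by omega
  rw [← hy, Finset.card_le_one.1 h₂ x (hf.self_mem_crossing x) y
    (hf.mem_crossing hy' hy.ge)]

/-- The only inversions come from a throw at `x ∈ S`, which overtakes just the points before the
next element of `S`. An element of `S` in `(b - n, b)` serves as both `p` and `z` in `separated`. -/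
theorem IsThrow.isShuffle (hn : 2 ≤ n) (hf : IsLift w f) (h : IsThrow n f S)
    (hS : ∀ b, S b → ∃ z, b - n < z ∧ z < b ∧ S z) : IsShuffle w f S where
  lift := hf
  period := h.period
  inversion x y hxy _ _ hlt := by
    have hy := (hf y).1
    by_cases hx : S x
    · obtain ⟨s, hs, -⟩ := exists_isNext_of_nonempty h.period ⟨x, hx⟩ x
      have h₁ := h.of_next x s hx hs
      exact ⟨hx, hs.2.2 y hxy (by omega), fun z hz hz' => hs.2.2 z hz (by omega)⟩
    · have := h.of_not x hx
      omega
  separated b hb _ := by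
    obtain ⟨z, h₁, h₂, h₃⟩ := hS b hb
    refine ⟨z, h₁, h₂, ?_, z, h₁, le_rfl, h₃⟩
    obtain ⟨s, hs, hs'⟩ := exists_isNext_of_nonempty h.period ⟨z, h₃⟩ z
    have h₄ := h.of_next z s h₃ hs
    have h₅ : (2 : ℤ) ≤ n := by exact_mod_cast hn
    omega

/-- At time 1 the balls in the air are the one thrown from `0` and the one thrown from the last
element of `S` before `0`. -/
theorem IsThrow.aexc_eq (hf : IsLift w f) (h : IsThrow n f S) (hne : ∃ s, S s) :
    aexc w + 2 = 2 * n := by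
  classical
  obtain ⟨s₀, ⟨h₁, h₂⟩, h₃⟩ : ∃ s, (s < 0 ∧ S s) ∧ ∀ z, z < 0 ∧ S z → z ≤ s := by
    refine Int.exists_greatest_of_bdd ⟨0, fun z hz => hz.1.le⟩ ?_
    obtain ⟨s, hs, hs'⟩ := exists_isNext_of_nonempty h.period hne (-n - 1)
    exact ⟨s, by omega, hs.2.1⟩
  obtain ⟨s, hs, -⟩ := exists_isNext_of_nonempty h.period hne s₀
  have hfs := h.of_next s₀ s h₂ hs
  have hs0 : 0 ≤ s := by
    by_contra! hc
    have := h₃ s ⟨hc, hs.2.1⟩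
    have := hs.1
    omega
  have h₄ : crossing n f 1 = {0, s₀} := by
    ext x
    rw [Finset.mem_insert, Finset.mem_singleton]
    constructor
    · intro hx
      rw [Hyperoctahedral.mem_crossing] at hx
      by_contra! hc
      by_cases hSx : S x
      · have h₅ := h₃ x ⟨by omega, hSx⟩
        obtain ⟨t, ht, -⟩ := exists_isNext_of_nonempty h.period hne x
        have h₆ := h.of_next x t hSx ht
        have h₇ := ht.le (y := s₀) (by omega) h₂
        omega
      · have := h.of_not x hSx
        omega
    · rintro (rfl | rfl)
      · exact hf.self_mem_crossing 0
      · exact hf.mem_crossing (by omega) (by omega)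
  have h₅ := hf.aexc_add_card_crossing 1
  rwa [h₄, Finset.card_pair (by omega)] at h₅

/-- If `S` is a single class modulo `n`, then the projection has two nontrivial cycles. -/
theorem IsThrow.exists_between_of_cyc (hn : 2 ≤ n) (hf : IsLift w f) (h : IsThrow n f S)
    (hw : cyc (piT w) = 1) (b : ℤ) (hb : S b) : ∃ z, b - n < z ∧ z < b ∧ S z := by
  by_contra! hc
  -- The half turn `(b, b + n]` and its opposite are the two blocks. If `S` has no other class,
  -- `w⁻¹` rotates them, since `f (b + n) = b + 2n + 1` restarts the half turn.
  have hP : IsNC n (cut n b (b + n) fun _ _ => True) := isNC_cut isNC_true (by omega)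
  have hbn : S (b + n) := (h.period b).2 hb
  have hbet : ∀ x, b < x → x < b + n → ¬ S x := fun x h₁ h₂ hx =>
    hc (x - n) (by omega) (by omega) (by rw [← h.period, sub_add_cancel]; exact hx)
  have hfb : f b = b + n + 1 := h.of_next b (b + n) hb ⟨by omega, hbn, hbet⟩
  have hfbn := hf.add_self b
  have hrot : Rot (cut n b (b + n) fun _ _ => True) w⁻¹ := by
    refine rot_of_half hP b fun x hx hx' => ⟨f x, ?_, (hf x).2.2.symm⟩
    by_cases hxb : x = b + n
    · subst hxb
      refine ⟨by omega, ⟨trivial, ?_, ?_⟩, fun y hy hy' hcut => ?_⟩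
      · rw [arc_iff_two_turns (by omega) (by omega) (by omega),
          arc_iff_two_turns (by omega) (by omega) (by omega)]
        omega
      · rw [arc_iff_two_turns (by omega) (by omega) (by omega),
          arc_iff_two_turns (by omega) (by omega) (by omega)]
        omega
      · have h₁ := hcut.2.1
        rw [arc_iff_two_turns (by omega) (by omega) (by omega),
          arc_iff_two_turns (by omega) (by omega) (by omega)] at h₁
        omega
    · rw [h.of_not x (hbet x hx (by omega))]
      refine ⟨by omega, ⟨trivial, ?_, ?_⟩, fun y hy hy' hcut => by omega⟩
      · rw [arc_iff_two_turns (by omega) (by omega) (by omega),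
          arc_iff_two_turns (by omega) (by omega) (by omega)]
        omega
      · rw [arc_iff_two_turns (by omega) (by omega) (by omega),
          arc_iff_two_turns (by omega) (by omega) (by omega)]
        omega
  -- A single nontrivial block would contain both `b` and `b + n`, but the closure refines this
  -- partition, which separates them.
  have hrel := rel_of_cyc_eq_one hn hw (x := b) (y := b + n)
    (mt hf.eq_add_iff.2 (by omega)) (mt hf.eq_add_iff.2 (by omega)) _ hP fun x y hxy =>
      hP.symm (hrot.rel hP (by rw [← hxy]; exact w.1.symm_apply_apply _))
  have h₁ := hrel.2.1
  rw [← arc_add_two_mul, arc_iff_two_turns (by omega) (by omega) (by omega),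
    arc_iff_two_turns (by omega) (by omega) (by omega)] at h₁
  omega

theorem isSplittable_iff (hn : 2 ≤ n) (hf : IsLift w f) :
    IsSplittable w ↔ IsThrow n f (fun x => f x ≠ x + 1) ∧ (∃ s, f s ≠ s + 1) ∧
      ∀ b, f b ≠ b + 1 → ∃ z, b - n < z ∧ z < b ∧ f z ≠ z + 1 := by
  constructor
  · rintro ⟨h₁, h₂⟩
    have h := hf.isThrow_of_aexc h₁.ge
    exact ⟨h, hf.exists_ne_of_aexc h₁, h.exists_between_of_cyc hn hf h₂⟩
  · rintro ⟨h₁, h₂, h₃⟩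
    have h := h₁.aexc_eq hf h₂
    refine ⟨h, (h₁.isShuffle hn hf h₃).cyc_eq_one hn ?_⟩
    rintro rfl
    simp [aexc] at h
    omega

theorem ncard_forwardOrbit_eq_iff (hn : 2 ≤ n) (w : hyperoctahedral n) :
    (forwardOrbit pop w).ncard = 2 * n - 1 ↔ IsSplittable w := by
  obtain ⟨f, hf⟩ := exists_isLift w
  constructor
  · intro h
    have h₁ := ncard_forwardOrbit_le hn w
    have h₂ := aexc_lt w
    -- With one ball, `f x = x + 1` has no inversions, so the empty set serves as `S` and the orbit
    -- has `2n` elements, one too many.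
    have h₃ : aexc w + 1 ≠ 2 * n := by
      intro hc
      have h₄ : IsThrow n f fun _ => False :=
        ⟨fun _ => Iff.rfl, fun x _ => hf.eq_add_one_of_aexc hc x, fun _ _ h => h.elim⟩
      have h₅ := (h₄.isShuffle hn hf fun _ h => h.elim).ncard_forwardOrbit hn
      omega
    have h₄ : aexc w + 2 = 2 * n := by omega
    have hw : w ≠ 1 := by
      rintro rfl
      simp [aexc] at h₄
      omega
    refine ⟨h₄, ?_⟩
    -- The orbit attains its upper bound, so the first step may lose only one antiexceedance.
    have h₅ := ncard_forwardOrbit_pop hn hw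
    have h₆ := ncard_forwardOrbit_le hn (pop w)
    have h₇ := aexc_eq_add_cyc hn w
    have h₈ := cyc_piT_pos hn hw
    omega
  · intro h
    obtain ⟨h₁, -, h₃⟩ := (isSplittable_iff hn hf).1 h
    have h₄ := (h₁.isShuffle hn hf h₃).ncard_forwardOrbit hn
    have h₅ := h.1
    omega

end Hyperoctahedral

/-! ### Counting splittable elements by subsets of [n] -/

namespace Hyperoctahedral

open SignedPt

variable {n : ℕ}

/-- The subset `s` of `[n]`, extended to a set of integers that is periodic modulo `n`. -/
def periodize (s : Finset (Fin n)) (x : ℤ) : Prop := ∃ i ∈ s, ∃ k : ℤ, x = (i : ℕ) + n * k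

theorem periodize_add (s : Finset (Fin n)) (x : ℤ) : periodize s (x + n) ↔ periodize s x := by
  constructor
  · rintro ⟨i, hi, k, hk⟩
    exact ⟨i, hi, k - 1, by linarith⟩
  · rintro ⟨i, hi, k, hk⟩
    exact ⟨i, hi, k + 1, by linarith⟩

theorem card_filter_two_le_card :
    ((Finset.univ : Finset (Finset (Fin n))).filter fun s => 2 ≤ s.card).card =
      2 ^ n - n - 1 := by
  have h₁ := Finset.card_filter_add_card_filter_not (s := (Finset.univ : Finset (Finset (Fin n))))
    (fun s => 2 ≤ s.card)
  have h₂ : ((Finset.univ : Finset (Finset (Fin n))).filter fun s => ¬ 2 ≤ s.card) =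
      Finset.powersetCard 0 Finset.univ ∪ Finset.powersetCard 1 Finset.univ := by
    ext s
    simp only [Finset.mem_filter, Finset.mem_univ, true_and, Finset.mem_union,
      Finset.mem_powersetCard, Finset.subset_univ]
    omega
  rw [h₂, Finset.card_union_of_disjoint] at h₁
  · simp only [Finset.card_powersetCard, Finset.card_univ, Fintype.card_fin,
      Fintype.card_finset, Nat.choose_zero_right, Nat.choose_one_right] at h₁
    omega
  · rw [Finset.disjoint_left]
    intro s hs hs'
    rw [Finset.mem_powersetCard] at hs hs'
    omega

variable [NeZero n] {w : hyperoctahedral n} {f : ℤ → ℤ} {S : ℤ → Prop}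

theorem IsThrow.eq {g : ℤ → ℤ} (hf : IsThrow n f S) (hg : IsThrow n g S) : f = g := by
  funext x
  by_cases hx : S x
  · obtain ⟨s, hs, -⟩ := exists_isNext_of_nonempty hf.period ⟨x, hx⟩ x
    rw [hf.of_next x s hx hs, hg.of_next x s hx hs]
  · rw [hf.of_not x hx, hg.of_not x hx]

theorem IsThrow.ne_iff (h : IsThrow n f S) (x : ℤ) : f x ≠ x + 1 ↔ S x := by
  constructor
  · intro hx
    by_contra hc
    exact hx (h.of_not x hc)
  · intro hx
    obtain ⟨s, hs, -⟩ := exists_isNext_of_nonempty h.period ⟨x, hx⟩ x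
    have h₁ := h.of_next x s hx hs
    have h₂ := hs.1
    omega

theorem IsLift.unique {u : hyperoctahedral n} (hw : IsLift w f) (hu : IsLift u f) : w = u := by
  refine inv_injective (ext_ofInt fun x => ?_)
  exact (hw x).2.2.symm.trans (hu x).2.2

theorem exists_isThrow (hn : 2 ≤ n) (hS : ∀ x, S (x + n) ↔ S x) (hne : ∃ s, S s) :
    ∃ (w : hyperoctahedral n) (f : ℤ → ℤ), IsLift w f ∧ IsThrow n f S := by
  classical
  choose g hg hg' using exists_isNext_of_nonempty hS hne
  let f : ℤ → ℤ := fun x => if S x then g x + 1 else x + 1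
  have hf₁ : ∀ x, S x → f x = g x + 1 := fun x hx => if_pos hx
  have hf₂ : ∀ x, ¬ S x → f x = x + 1 := fun x hx => if_neg hx
  have hgn : ∀ x, g (x + n) = g x + n := by
    intro x
    refine (hg (x + n)).unique ⟨by linarith [(hg x).1], (hS _).2 (hg x).2.1, ?_⟩
    intro y hy hy' hc
    refine (hg x).2.2 (y - n) (by linarith) (by linarith) ?_
    exact (hS _).1 (by rwa [sub_add_cancel])
  have hfn : ∀ x, f (x + n) = f x + n := by
    intro x
    by_cases hx : S x
    · rw [hf₁ x hx, hf₁ _ ((hS x).2 hx), hgn]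
      ring
    · rw [hf₂ x hx, hf₂ _ (mt (hS x).1 hx)]
      ring
  have hfk : ∀ x k : ℤ, f (x + n * k) = f x + n * k := by
    intro x k
    induction k using Int.induction_on with
    | zero => simp
    | succ k ih => rw [mul_add, mul_one, ← add_assoc, hfn, ih]; ring
    | pred k ih =>
      have := hfn (x + n * (-k - 1))
      rw [show x + n * (-k - 1) + n = x + n * (-(k : ℤ)) by ring, ih] at this
      linarith
  have hlt : ∀ x y, x < y → f x ≠ f y := by
    intro x y hxy h
    by_cases hx : S x
    · rw [hf₁ x hx] at h
      by_cases hy : S y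
      · rw [hf₁ y hy] at h
        have h₁ := (hg x).le hxy hy
        have h₂ := (hg y).1
        omega
      · rw [hf₂ y hy] at h
        exact hy ((show g x = y by omega) ▸ (hg x).2.1)
    · rw [hf₂ x hx] at h
      by_cases hy : S y
      · rw [hf₁ y hy] at h
        have h₂ := (hg y).1
        omega
      · rw [hf₂ y hy] at h
        omega
  obtain ⟨u, hu⟩ := exists_of_lift f hfn fun x y h => by
    obtain ⟨k, hk⟩ := ofInt_eq_iff.1 h
    rw [show (2 : ℤ) * n * k = n * (2 * k) by ring, ← hfk] at hk
    rw [ofInt_eq_iff]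
    refine ⟨k, ?_⟩
    rw [show (2 : ℤ) * n * k = n * (2 * k) by ring]
    rcases lt_trichotomy y (x + n * (2 * k)) with h₁ | h₁ | h₁
    · exact absurd hk (hlt _ _ h₁)
    · exact h₁
    · exact absurd hk.symm (hlt _ _ h₁)
  -- The inverse appears because `IsLift` lifts `w⁻¹`.
  refine ⟨u⁻¹, f, fun x => ⟨?_, ?_, ?_⟩, hS, hf₂, fun x s hx hs => ?_⟩
  · by_cases hx : S x
    · rw [hf₁ x hx]
      have := (hg x).1
      omega
    · rw [hf₂ x hx]
      omega
  · have h₂ : (2 : ℤ) ≤ n := by exact_mod_cast hn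
    by_cases hx : S x
    · rw [hf₁ x hx]
      have := hg' x
      omega
    · rw [hf₂ x hx]
      omega
  · rw [← hu x]
    exact congrArg (fun v : hyperoctahedral n => v.1 (ofInt x)) (inv_inv u).symm
  · rw [hf₁ x hx, hs.unique (hg x)]

open Classical in
/-- The points of `[n]` that the lift of `w⁻¹` does not send to their successor. -/
noncomputable def throwSet (w : hyperoctahedral n) : Finset (Fin n) :=
  Finset.univ.filter fun i => w.1⁻¹ (ofInt (i : ℕ)) ≠ ofInt ((i : ℕ) + 1)

theorem IsLift.mem_throwSet (hf : IsLift w f) {i : Fin n} :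
    i ∈ throwSet w ↔ f (i : ℕ) ≠ (i : ℕ) + 1 := by
  have hn := two_mul_pos n
  simp only [throwSet, Finset.mem_filter, Finset.mem_univ, true_and]
  refine not_congr ⟨fun h => hf.eq_of_ofInt (by omega) (by omega) h.symm, fun h => ?_⟩
  rw [← (hf _).2.2, h]

theorem exists_fin (x : ℤ) : ∃ (i : Fin n) (k : ℤ), x = (i : ℕ) + n * k := by
  obtain ⟨y, k, h₁, h₂, rfl⟩ := exists_window_half (n := n) (-1) x
  refine ⟨⟨y.toNat, by omega⟩, k, ?_⟩
  rw [Int.toNat_of_nonneg (by omega)]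

theorem fin_eq_of_eq_add {i j : Fin n} {k : ℤ} (h : ((i : ℕ) : ℤ) = (j : ℕ) + n * k) : i = j := by
  have h₁ := i.2
  have h₂ := j.2
  have hn : (0 : ℤ) < n := by exact_mod_cast NeZero.pos n
  have hk : k = 0 := by
    have h₃ : (n : ℤ) * k < n * 1 := by linarith [(Int.ofNat_lt.2 h₁), Int.natCast_nonneg j.1]
    have h₄ : (n : ℤ) * (-1) < n * k := by
      linarith [(Int.ofNat_lt.2 h₂), Int.natCast_nonneg i.1]
    have h₅ := lt_of_mul_lt_mul_left h₃ hn.le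
    have h₆ := lt_of_mul_lt_mul_left h₄ hn.le
    omega
  rw [hk, mul_zero, add_zero] at h
  exact Fin.ext (by exact_mod_cast h)

theorem periodize_coe {s : Finset (Fin n)} {i : Fin n} : periodize s (i : ℕ) ↔ i ∈ s := by
  constructor
  · rintro ⟨j, hj, k, hk⟩
    rwa [fin_eq_of_eq_add hk]
  · exact fun hi => ⟨i, hi, 0, by simp⟩

/-- By periodicity the subset of `[n]` determines `S`, which determines the throws `f`, and these
determine the element. -/
theorem eq_of_throwSet_eq (hn : 2 ≤ n) {u w : hyperoctahedral n} (hu : IsSplittable u)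
    (hw : IsSplittable w) (h : throwSet u = throwSet w) : u = w := by
  obtain ⟨f, hf⟩ := exists_isLift u
  obtain ⟨g, hg⟩ := exists_isLift w
  have h₁ := ((isSplittable_iff hn hf).1 hu).1
  have h₂ := ((isSplittable_iff hn hg).1 hw).1
  have h₃ : (fun x => f x ≠ x + 1) = fun x => g x ≠ x + 1 := by
    funext x
    obtain ⟨i, k, rfl⟩ := exists_fin (n := n) x
    have h₄ := period_mul (S := fun x => f x ≠ x + 1) h₁.period (i : ℕ) k
    have h₅ := period_mul (S := fun x => g x ≠ x + 1) h₂.period (i : ℕ) k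
    refine propext (h₄.trans (Iff.trans ?_ h₅.symm))
    rw [← hf.mem_throwSet, ← hg.mem_throwSet, h]
  rw [h₃] at h₁
  rw [h₁.eq h₂] at hf
  exact hf.unique hg

/-- An element of `S` strictly between `b - n` and `b` is in a class modulo `n` other than that of
`b`. -/
theorem two_le_card_throwSet (hn : 2 ≤ n) (hw : IsSplittable w) : 2 ≤ (throwSet w).card := by
  obtain ⟨f, hf⟩ := exists_isLift w
  obtain ⟨h₁, ⟨b, hb⟩, h₂⟩ := (isSplittable_iff hn hf).1 hw
  obtain ⟨z, hz₁, hz₂, hz⟩ := h₂ b hb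
  have key : ∀ x, f x ≠ x + 1 → ∃ i ∈ throwSet w, ∃ k : ℤ, x = (i : ℕ) + n * k := by
    intro x hx
    obtain ⟨i, k, rfl⟩ := exists_fin (n := n) x
    exact ⟨i, hf.mem_throwSet.2 
      ((period_mul (S := fun x => f x ≠ x + 1) h₁.period _ k).1 hx), k, rfl⟩
  obtain ⟨i, hi, k, rfl⟩ := key b hb
  obtain ⟨j, hj, l, rfl⟩ := key z hz
  refine Finset.one_lt_card.2 ⟨i, hi, j, hj, ?_⟩
  rintro rfl
  have hn0 : (0 : ℤ) < n := by exact_mod_cast NeZero.pos n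
  have h₃ : l < k := by nlinarith
  have h₄ : k < l + 1 := by nlinarith
  omega

theorem exists_throwSet_eq (hn : 2 ≤ n) {s : Finset (Fin n)} (hs : 2 ≤ s.card) :
    ∃ w : hyperoctahedral n, IsSplittable w ∧ throwSet w = s := by
  obtain ⟨i, hi, j, hj, hij⟩ := Finset.one_lt_card.1 hs
  obtain ⟨w, f, hf, hS⟩ := exists_isThrow hn (periodize_add s) ⟨_, periodize_coe.2 hi⟩
  have hSeq : periodize s = fun x => f x ≠ x + 1 := funext fun x => propext (hS.ne_iff x).symm
  refine ⟨w, (isSplittable_iff hn hf).2 ⟨hSeq ▸ hS, ?_, ?_⟩, ?_⟩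
  · exact ⟨_, (hS.ne_iff _).2 (periodize_coe.2 hi)⟩
  · intro b hb
    obtain ⟨a, ha, k, rfl⟩ := (hS.ne_iff b).1 hb
    obtain ⟨c, hc, hac⟩ : ∃ c ∈ s, c ≠ a := by
      by_cases h : i = a
      · exact ⟨j, hj, fun h' => hij (h.trans h'.symm)⟩
      · exact ⟨i, hi, h⟩
    -- The representative of the second class in the half turn ending at `b` cannot be `b`, so it
    -- lies strictly between `b - n` and `b`.
    obtain ⟨y, l, h₁, h₂, h₃⟩ := exists_window_half (n := n) ((a : ℕ) + n * k - n) (c : ℕ)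
    have hne : y ≠ (a : ℕ) + n * k := by
      rintro rfl
      exact hac (fin_eq_of_eq_add (k := k + l) (by rw [h₃]; ring))
    refine ⟨y, h₁, by omega, (hS.ne_iff y).2 ⟨c, hc, -l, ?_⟩⟩
    rw [h₃]
    ring
  · ext a
    rw [hf.mem_throwSet, hS.ne_iff, periodize_coe]

theorem ncard_isSplittable (hn : 2 ≤ n) :
    {w : hyperoctahedral n | IsSplittable w}.ncard = 2 ^ n - n - 1 := by
  rw [← card_filter_two_le_card (n := n), ← Set.ncard_coe_finset]
  refine Set.ncard_congr (fun w _ => throwSet w) ?_ ?_ ?_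
  · intro w hw
    simpa using two_le_card_throwSet hn hw
  · exact fun u w hu hw h => eq_of_throwSet_eq hn hu hw h
  · intro s hs
    obtain ⟨w, hw, h⟩ := exists_throwSet_eq hn (s := s) (by simpa using hs)
    exact ⟨w, hw, h⟩

end Hyperoctahedral

theorem theorem1p6 (n : ℕ) (hn : 2 ≤ n) :
    (∀ w : hyperoctahedral n,
      (forwardOrbit Hyperoctahedral.pop w).ncard = 2 * n - 1 ↔ Hyperoctahedral.IsSplittable w) ∧
    {w : hyperoctahedral n |
      (forwardOrbit Hyperoctahedral.pop w).ncard = 2 * n - 1}.ncard = 2 ^ n - n - 1 := by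
  have : NeZero n := ⟨by omega⟩
  refine ⟨Hyperoctahedral.ncard_forwardOrbit_eq_iff hn, ?_⟩
  simp only [Hyperoctahedral.ncard_forwardOrbit_eq_iff hn]
  exact Hyperoctahedral.ncard_isSplittable hn
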